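/- **Setting.** Let $\mathcal P_2(\mathbb R^d)$ be the set of probability measures on $\mathbb R^d$ with finite second moment, and let $I\subseteq\mathbb R$ be an open interval. *Convective derivative.* For a time-dependent vector field $\Phi_t$ and a time-dependent tensor field $g_t$ on $\mathbb R^d$ put $(\mathcal D g)_t=\partial_t g_t+\Phi_t\cdot\nabla g_t$; let $\mathcal D^0\Phi=\Phi$ and $\mathcal D^{j+1}\Phi=\mathcal D(\mathcal D^{j}\Phi)$. *Transport couples.* A transport couple on $I$ is a narrowly continuous curve $t\mapsto\mu_t\in\mathcal P_2(\mathbb R^d)$ together with smooth vector fields $\Phi_t\in L^2_{\mu_t}$, $t\in I$, such that $\int_K\int\|\Phi_t\|^2\,d\mu_t\,dt<\infty$ for every compact $K\subset I$ and $\partial_t\mu_t=-\nabla\cdot(\mu_t\Phi_t)$ in the sense of distributions on $I\times\mathbb R^d$. It is *regular* if $(t,x)\mapsto\Phi_t(x)$ is $C^\infty$ on $I\times\mathbb R^d$ and, for every $j\ge 0$, $(\mathcal D^j\Phi)_t$ is globally Lipschitz in $x$, locally uniformly in $t\in I$. A *convective geodesic* is a regular transport couple with $\partial_t\Phi_t+\Phi_t\cdot\nabla\Phi_t=0$.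 *Wasserstein differentials.* Let $\mathfrak X_{\mathrm{Lip}}$ be the vector space of $C^\infty$ globally Lipschitz vector fields on $\mathbb R^d$ (contained in $L^2_\mu$ for every $\mu\in\mathcal P_2(\mathbb R^d)$). For $\mathcal F:\mathcal P_2(\mathbb R^d)\to\mathbb R$, a $k$-th order Wasserstein differential of $\mathcal F$ at $\mu$ is a symmetric $k$-linear form $D^k_\mu\mathcal F$ on $\mathfrak X_{\mathrm{Lip}}$ such that, for every convective geodesic $(\nu_s,\Psi_s)_{s\in J}$ on an open interval $J$ and every $t\in J$ with $\nu_t=\mu$, the function $s\mapsto\mathcal F(\nu_s)$ is $C^k$ near $t$ and $\frac{d^k}{ds^k}\big|_{s=t}\mathcal F(\nu_s)=D^k_\mu\mathcal F(\Psi_t,\dots,\Psi_t)$. It is extended to a linear form on $\mathfrak X_{\mathrm{Lip}}^{\otimes k}$, written $D^k_\mu\mathcal F:(\Psi_1\otimes\dots\otimes\Psi_k)=D^k_\mu\mathcal F(\Psi_1,\dots,\Psi_k)$. *Regularity of functionals.* A smooth deformation of the identity is a $C^\infty$ map $(a,x)\mapsto T_a(x)\in\mathbb R^d$ on $U\times\mathbb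 R^d$, where $U$ is an open neighbourhood of $0$ in some $\mathbb R^m$, with $T_0=\mathrm{id}$ and such that every derivative of $T_a(x)$ in $a$ (of any order $\ge 0$) is globally Lipschitz in $x$, locally uniformly in $a\in U$. We say that $\mathcal F$ is of class $C^n$ at $\mu$ if for every such deformation the function $a\mapsto\mathcal F((T_a)_\sharp\mu)$ is of class $C^n$ near $a=0$. *Bell polynomials.* Let $$B_{n,k}(X_1,\dots,X_{n-k+1})=\sum_{h}\frac{n!}{\prod_i h_i!\,(i!)^{h_i}}\;X_1^{h_1}X_2^{h_2}\cdots,$$ the sum being over $h_1,h_2,\dots\ge 0$ with $\sum_i h_i=k$ and $\sum_i i\,h_i=n$, and evaluate it at vector fields by reading products as tensor products. **Theorem (Faà di Bruno formula on Wasserstein space).** Let $(\mu_t,\Phi_t)_{t\in I}$ be a regular transport couple, let $n\ge 1$, and let $\mathcal F:\mathcal P_2(\mathbb R^d)\to\mathbb R$ be of class $C^n$ at $\mu_t$ for every $t\in I$. Then $t\mapsto\mathcal F(\mu_t)$ is of class $C^n$ on $I$; for every $t\in I$ and $1\le k\le n$ the functional $\mathcal F$ has exactly one $k$-th order Wasserstein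 differential $D^k_{\mu_t}\mathcal F$ at $\mu_t$; and for every $t\in I$ $$\frac{d^n}{dt^n}\mathcal F(\mu_t)=\sum_{k=1}^n D^k_{\mu_t}\mathcal F : B_{n,k}\big(\Phi_t,(\mathcal D\Phi)_t,(\mathcal D^2\Phi)_t,\dots,(\mathcal D^{n-k}\Phi)_t\big).$$ -/

import Mathlib

open MeasureTheory Set
open scoped ContDiff NNReal ENNReal Nat TensorProduct Topology

/-- Euclidean space of dimension `d`. -/
abbrev Eucl (d : ℕ) : Type := EuclideanSpace ℝ (Fin d)

/-- Probability measures on `ℝ^d` with finite second moment (with the narrow topology). -/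
abbrev P2 (d : ℕ) : Type := {μ : ProbabilityMeasure (Eucl d) // MemLp id 2 (μ : Measure (Eucl d))}

/-- The underlying measure. -/
noncomputable abbrev P2.meas {d : ℕ} (μ : P2 d) : Measure (Eucl d) := (μ.1 : Measure (Eucl d))

/-- The convective derivative `𝒟 g = ∂_t g + Φ · ∇ g` of a time-dependent tensor field `g`
(with components in a normed space `G`) relative to the velocity field `Φ`. -/
noncomputable def convDeriv {d : ℕ} {G : Type*} [NormedAddCommGroup G] [NormedSpace ℝ G]
    (Φ : ℝ → Eucl d → Eucl d) (g : ℝ → Eucl d → G) : ℝ → Eucl d → G :=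
  fun t x => deriv (fun s => g s x) t + fderiv ℝ (g t) x (Φ t x)

/-- The iterated convective derivatives `𝒟^j Φ` of the velocity field itself. -/
noncomputable def iterConv {d : ℕ} (Φ : ℝ → Eucl d → Eucl d) : ℕ → ℝ → Eucl d → Eucl d
  | 0 => Φ
  | j + 1 => convDeriv Φ (iterConv Φ j)

/-- Transport couples on `I`: a narrowly continuous curve in `P_2` with a spatially smooth
velocity field, locally square integrable in time, that solves the continuity equation
`∂_t μ = - ∇ · (μ Φ)` in the sense of distributions on `I × ℝ^d`. -/
structure IsTransportCouple {d : ℕ} (I : Set ℝ) (μ : ℝ → P2 d) (Φ : ℝ → Eucl d → Eucl d) :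
    Prop where
  continuousOn : ContinuousOn μ I
  contDiff : ∀ t ∈ I, ContDiff ℝ ∞ (Φ t)
  memLp : ∀ t ∈ I, MemLp (Φ t) 2 (μ t).meas
  sq_integrable : ∀ K ⊆ I, IsCompact K →
    ∫⁻ t in K, ∫⁻ x, ‖Φ t x‖ₑ ^ 2 ∂(μ t).meas < ⊤
  continuity_eq : ∀ η : ℝ → Eucl d → ℝ, ContDiff ℝ ∞ (Function.uncurry η) →
    HasCompactSupport (Function.uncurry η) →
    tsupport (Function.uncurry η) ⊆ I ×ˢ (univ : Set (Eucl d)) →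
    ∫ t in I, ∫ x, (deriv (fun s => η s x) t + fderiv ℝ (η t) x (Φ t x)) ∂(μ t).meas = 0

/-- Regular transport couples: the velocity field is smooth in `(t, x)`, and each of its iterated
convective derivatives is globally Lipschitz in space, locally uniformly in time. -/
structure IsRegularTransportCouple {d : ℕ} (I : Set ℝ) (μ : ℝ → P2 d)
    (Φ : ℝ → Eucl d → Eucl d) : Prop extends IsTransportCouple I μ Φ where
  contDiffOn : ContDiffOn ℝ ∞ (Function.uncurry Φ) (I ×ˢ (univ : Set (Eucl d)))
  lipschitz : ∀ j : ℕ, ∀ K ⊆ I, IsCompact K → ∃ L : ℝ≥0, ∀ t ∈ K, LipschitzWith L (iterConv Φ j t)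

/-- Regular convective geodesics: `∂_t Φ + Φ · ∇ Φ = 0`. -/
structure IsConvectiveGeodesic {d : ℕ} (I : Set ℝ) (μ : ℝ → P2 d)
    (Φ : ℝ → Eucl d → Eucl d) : Prop extends IsRegularTransportCouple I μ Φ where
  convDeriv_eq_zero : ∀ t ∈ I, ∀ x, convDeriv Φ Φ t x = 0

/-- The space of smooth, globally Lipschitz vector fields on `ℝ^d`. -/
def LipField (d : ℕ) : Submodule ℝ (Eucl d → Eucl d) where
  carrier := {Ψ | ContDiff ℝ ∞ Ψ ∧ ∃ L : ℝ≥0, LipschitzWith L Ψ}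
  add_mem' := by
    rintro f g ⟨hf, L, hL⟩ ⟨hg, M, hM⟩
    exact ⟨hf.add hg, L + M, hL.add hM⟩
  zero_mem' := ⟨contDiff_const, 0, LipschitzWith.const 0⟩
  smul_mem' := by
    rintro c f ⟨hf, L, hL⟩
    exact ⟨contDiff_const.smul hf, ‖c‖₊ * L, (lipschitzWith_smul c).comp hL⟩

/-- Smooth Lipschitz fields are square integrable for every measure in `P_2`. -/
theorem LipField.memLp {d : ℕ} (μ : P2 d) (Ψ : LipField d) :
    MemLp (Ψ : Eucl d → Eucl d) 2 μ.meas := by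
  obtain ⟨Ψ, hc, L, hL⟩ := Ψ
  have h0 : MemLp (fun x : Eucl d => ‖x‖) 2 μ.meas := μ.2.norm
  have h1 : MemLp (fun x : Eucl d => ‖Ψ 0‖ + (L : ℝ) * ‖x‖) 2 μ.meas :=
    (memLp_const (μ := μ.meas) (p := 2) ‖Ψ 0‖).add (h0.const_mul (L : ℝ))
  refine h1.mono' hc.continuous.aestronglyMeasurable (ae_of_all _ fun x => ?_)
  have h2 := hL.norm_sub_le x 0
  have h3 := norm_add_le (Ψ 0) (Ψ x - Ψ 0)
  rw [add_sub_cancel] at h3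
  rw [sub_zero] at h2
  change ‖Ψ x‖ ≤ _
  linarith

/-- Convective derivatives of jointly smooth fields are jointly smooth. -/
theorem convDeriv_contDiffOn {d : ℕ} {I : Set ℝ} (hI : IsOpen I) {Φ g : ℝ → Eucl d → Eucl d}
    (hΦ : ContDiffOn ℝ ∞ (Function.uncurry Φ) (I ×ˢ (univ : Set (Eucl d))))
    (hg : ContDiffOn ℝ ∞ (Function.uncurry g) (I ×ˢ (univ : Set (Eucl d)))) :
    ContDiffOn ℝ ∞ (Function.uncurry (convDeriv Φ g)) (I ×ˢ (univ : Set (Eucl d))) := by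
  have hO : IsOpen (I ×ˢ (univ : Set (Eucl d))) := hI.prod isOpen_univ
  have h1 : ContDiffOn ℝ ∞ (fun p => fderiv ℝ (Function.uncurry g) p ((1 : ℝ), Function.uncurry Φ p))
      (I ×ˢ (univ : Set (Eucl d))) :=
    (hg.fderiv_of_isOpen hO (by simp)).clm_apply (contDiffOn_const.prodMk hΦ)
  refine h1.congr ?_
  rintro ⟨t, x⟩ hp
  have hd : HasFDerivAt (Function.uncurry g) (fderiv ℝ (Function.uncurry g) (t, x)) (t, x) :=
    ((hg.contDiffAt (hO.mem_nhds hp)).differentiableAt (by simp)).hasFDerivAt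
  have ht : HasDerivAt (fun s => g s x) (fderiv ℝ (Function.uncurry g) (t, x) (1, 0)) t :=
    hd.comp_hasDerivAt (f := fun s => (s, x)) t
      ((hasDerivAt_id t).prodMk (hasDerivAt_const t x))
  have hx : HasFDerivAt (g t)
      ((fderiv ℝ (Function.uncurry g) (t, x)).comp (ContinuousLinearMap.inr ℝ ℝ (Eucl d))) x :=
    hd.comp x (hasFDerivAt_prodMk_right t x)
  simp only [Function.uncurry, convDeriv]
  rw [ht.deriv, hx.fderiv]
  simp only [ContinuousLinearMap.comp_apply, ContinuousLinearMap.inr_apply]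
  rw [← map_add]
  simp

theorem iterConv_contDiffOn {d : ℕ} {I : Set ℝ} (hI : IsOpen I) {Φ : ℝ → Eucl d → Eucl d}
    (hΦ : ContDiffOn ℝ ∞ (Function.uncurry Φ) (I ×ˢ (univ : Set (Eucl d)))) (j : ℕ) :
    ContDiffOn ℝ ∞ (Function.uncurry (iterConv Φ j)) (I ×ˢ (univ : Set (Eucl d))) := by
  induction j with
  | zero => exact hΦ
  | succ j ih => exact convDeriv_contDiffOn hI hΦ ih

/-- Along a regular transport couple every `(𝒟^j Φ)_t` is a smooth Lipschitz field. -/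
theorem iterConv_mem {d : ℕ} {I : Set ℝ} (hI : IsOpen I) {μ : ℝ → P2 d}
    {Φ : ℝ → Eucl d → Eucl d} (h : IsRegularTransportCouple I μ Φ) {t : ℝ} (ht : t ∈ I) (j : ℕ) :
    iterConv Φ j t ∈ LipField d := by
  refine ⟨?_, ?_⟩
  · rw [← contDiffOn_univ]
    exact (iterConv_contDiffOn hI h.contDiffOn j).comp (f := fun x => (t, x))
      (contDiffOn_const.prodMk contDiffOn_id) (fun x _ => ⟨ht, mem_univ _⟩)
  · obtain ⟨L, hL⟩ := h.lipschitz j {t} (by simpa using ht) isCompact_singleton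
    exact ⟨L, hL t rfl⟩

/-- `(𝒟^j Φ)_t` as an element of the space of smooth Lipschitz fields. -/
noncomputable def iterConvField {d : ℕ} {I : Set ℝ} (hI : IsOpen I) {μ : ℝ → P2 d}
    {Φ : ℝ → Eucl d → Eucl d} (h : IsRegularTransportCouple I μ Φ) {t : ℝ} (ht : t ∈ I) (j : ℕ) :
    LipField d :=
  ⟨iterConv Φ j t, iterConv_mem hI h ht j⟩

/-- Real-valued `k`-linear forms over smooth Lipschitz fields. -/
abbrev FieldForm (d k : ℕ) : Type := MultilinearMap ℝ (fun _ : Fin k => LipField d) ℝ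

/-- `D` is the `k`-th order Wasserstein differential of `F` at `μ`: the symmetric `k`-linear form
with `d^k/dt^k F(ν_t) = D (Ψ_t, …, Ψ_t)` for every convective geodesic `(ν, Ψ)`, at each
time `t` at which it passes through `μ`. -/
def IsWassersteinDifferential {d : ℕ} (F : P2 d → ℝ) (k : ℕ) (μ : P2 d) (D : FieldForm d k) :
    Prop :=
  (∀ (σ : Equiv.Perm (Fin k)) (v : Fin k → LipField d), D (fun i => v (σ i)) = D v) ∧
  ∀ (J : Set ℝ) (hJ : IsOpen J), J.OrdConnected →
    ∀ (ν : ℝ → P2 d) (Ψ : ℝ → Eucl d → Eucl d) (h : IsConvectiveGeodesic J ν Ψ)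
      (t : ℝ) (ht : t ∈ J), ν t = μ →
        ContDiffAt ℝ k (fun s => F (ν s)) t ∧
        iteratedDeriv k (fun s => F (ν s)) t =
          D (fun _ => iterConvField hJ h.toIsRegularTransportCouple ht 0)

/-- A smooth `m`-parameter deformation of the identity map of `ℝ^d`, parametrised by an open
neighbourhood `U` of `0`; all parameter derivatives of `T_a(x)` are Lipschitz in `x`,
locally uniformly in `a`. -/
structure IsSmoothDeformation {d m : ℕ} (U : Set (Fin m → ℝ))
    (T : (Fin m → ℝ) → Eucl d → Eucl d) : Prop where
  isOpen : IsOpen U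
  zero_mem : (0 : Fin m → ℝ) ∈ U
  map_zero : T 0 = id
  contDiffOn : ContDiffOn ℝ ∞ (Function.uncurry T) (U ×ˢ (univ : Set (Eucl d)))
  lipschitz : ∀ j : ℕ, ∀ K ⊆ U, IsCompact K →
    ∃ L : ℝ≥0, ∀ a ∈ K, LipschitzWith L (fun x => iteratedFDeriv ℝ j (fun b => T b x) a)

/-- `F` is of class `C^n` at `μ`: for every smooth finite-parameter deformation `T` of the
identity, `a ↦ F((T_a)_♯ μ)` is of class `C^n` near `a = 0`. -/
def IsFunctionalCnAt {d : ℕ} (F : P2 d → ℝ) (n : ℕ) (μ : P2 d) : Prop :=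
  ∀ (m : ℕ) (U : Set (Fin m → ℝ)) (T : (Fin m → ℝ) → Eucl d → Eucl d),
    IsSmoothDeformation U T →
    ∀ ν : (Fin m → ℝ) → P2 d, (∀ a ∈ U, (ν a).meas = μ.meas.map (T a)) →
      ContDiffAt ℝ n (fun a => F (ν a)) 0

/-- The coefficient `n! / ∏ i, (h_i)! (i!)^(h_i)` of `∏ i, X_i ^ (h_i)` in the partial exponential
Bell polynomials of order `n`; the exponents are recorded by the partition of `n` in which
the part `i` occurs `h_i` times. -/
noncomputable def bellCoeff {n : ℕ} (p : n.Partition) : ℝ :=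
  (n ! : ℝ) / ∏ i ∈ p.parts.toFinset, (((p.parts.count i)! : ℝ) * (i ! : ℝ) ^ p.parts.count i)

/-- The Bell polynomial `B_{n,k}(X_1, X_2, …)` with products read as tensor products:
the sum over the partitions of `n` into `k` parts of
`α • X_1 ⊗ … ⊗ X_1 ⊗ X_2 ⊗ … ⊗ X_2 ⊗ …`. -/
noncomputable def bellTensor {V : Type*} [AddCommGroup V] [Module ℝ V] (n k : ℕ) (X : ℕ → V) :
    ⨂[ℝ] _ : Fin k, V :=
  ∑ p : n.Partition with p.parts.card = k,
    bellCoeff p • PiTensorProduct.tprod ℝ (fun i : Fin k => X ((p.parts.sort (· ≤ ·)).getD i 0))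

section IteratedDerivatives

universe u

/-- The iterated derivatives of a `C^n` function are symmetric. -/
theorem ContDiffAt.iteratedFDeriv_perm {E : Type u} [NormedAddCommGroup E] [NormedSpace ℝ E]
    (n : ℕ) : ∀ {F : Type u} [NormedAddCommGroup F] [NormedSpace ℝ F] {f : E → F} {x : E},
    ContDiffAt ℝ n f x → ∀ (σ : Equiv.Perm (Fin n)) (v : Fin n → E),
      iteratedFDeriv ℝ n f x (fun i => v (σ i)) = iteratedFDeriv ℝ n f x v := by
  induction n with
  | zero => exact fun _ σ v => congrArg _ (Subsingleton.elim _ _)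
  | succ n ih =>
    intro F _ _ f x hf σ
    rcases n with - | n
    · intro v
      congr 1
      funext i
      exact congrArg v (Fin.ext (by omega))
    have hmem : σ ∈ Submonoid.closure
        (Set.range fun i : Fin (n + 1) => Equiv.swap i.castSucc i.succ) := by
      rw [Equiv.Perm.mclosure_swap_castSucc_succ]
      trivial
    induction hmem using Submonoid.closure_induction with
    | one => exact fun v => rfl
    | mul σ τ _ _ h1 h2 =>
      intro v
      have := h2 (fun i => v (σ i))
      exact this.trans (h1 v)
    | mem σ hσ =>
      obtain ⟨i, rfl⟩ := hσ
      intro v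
      beta_reduce
      rcases Fin.eq_castSucc_or_eq_last i with ⟨j, rfl⟩ | rfl
      · have hfix : (Equiv.swap j.castSucc.castSucc j.castSucc.succ) (Fin.last (n + 1)) =
            Fin.last (n + 1) := by
          refine Equiv.swap_apply_of_ne_of_ne (Fin.castSucc_lt_last _).ne' ?_
          rw [Fin.succ_castSucc]
          exact (Fin.castSucc_lt_last _).ne'
        have hinit : Fin.init (fun i => v (Equiv.swap j.castSucc.castSucc j.castSucc.succ i)) =
            fun i => Fin.init v (Equiv.swap j.castSucc j.succ i) := by
          funext i
          simp only [Fin.init]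
          congr 1
          exact (Fin.castSucc_injective (n + 1)).swap_apply j.castSucc j.succ i
        have hf' : ContDiffAt ℝ ((n + 1 : ℕ) : WithTop ℕ∞) (fderiv ℝ f) x :=
          hf.fderiv_right (by push_cast; rfl)
        rw [iteratedFDeriv_succ_apply_right (fun i => v _), iteratedFDeriv_succ_apply_right v,
          hinit, hfix,
          ih hf' (Equiv.swap j.castSucc j.succ) (Fin.init v)]
      · rcases n with - | n
        · have hs : IsSymmSndFDerivAt ℝ f x := hf.isSymmSndFDerivAt (by simp)
          rw [iteratedFDeriv_two_apply, iteratedFDeriv_two_apply]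
          exact hs _ _
        · have hσ : (Equiv.swap (Fin.last (n + 1)).castSucc (Fin.last (n + 1)).succ) =
              Equiv.swap (Fin.last n).castSucc.succ (Fin.last n).succ.succ := by
            rw [← Fin.succ_last, Fin.succ_castSucc]
          rw [hσ]
          have hfix : (Equiv.swap (Fin.last n).castSucc.succ (Fin.last n).succ.succ) 0 = 0 :=
            Equiv.swap_apply_of_ne_of_ne (Fin.succ_ne_zero _).symm (Fin.succ_ne_zero _).symm
          have htail : Fin.tail (fun i => v (Equiv.swap (Fin.last n).castSucc.succ
              (Fin.last n).succ.succ i)) =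
              fun i => Fin.tail v (Equiv.swap (Fin.last n).castSucc (Fin.last n).succ i) := by
            funext i
            simp only [Fin.tail]
            congr 1
            exact (Fin.succ_injective (n + 2)).swap_apply _ _ i
          have hd : DifferentiableAt ℝ (iteratedFDeriv ℝ (n + 2) f) x :=
            hf.differentiableAt_iteratedFDeriv (by norm_cast; omega)
          rw [iteratedFDeriv_succ_apply_left (fun i => v _), iteratedFDeriv_succ_apply_left v, htail, hfix,
            ← fderiv_continuousMultilinear_apply_const_apply hd,
            ← fderiv_continuousMultilinear_apply_const_apply hd]
          congr 1
          refine Filter.EventuallyEq.fderiv_eq ?_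
          have hev : ∀ᶠ y in 𝓝 x, ContDiffAt ℝ ((n + 2 : ℕ) : WithTop ℕ∞) f y :=
            (hf.of_le (by norm_cast; omega)).eventually (fun h => ENat.natCast_ne_top (n + 2) (WithTop.coe_inj.1 h))
          filter_upwards [hev] with y hy
          exact ih hy _ _

theorem ContDiffAt.iteratedFDeriv_comp_continuousLinearMap {E F G : Type*} [NormedAddCommGroup E]
    [NormedSpace ℝ E] [NormedAddCommGroup F] [NormedSpace ℝ F] [NormedAddCommGroup G]
    [NormedSpace ℝ G] {f : E → F} {k : ℕ} (g : G →L[ℝ] E) {x : G} (hf : ContDiffAt ℝ k f (g x)) :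
    iteratedFDeriv ℝ k (fun y => f (g y)) x =
      (iteratedFDeriv ℝ k f (g x)).compContinuousLinearMap fun _ => g := by
  obtain ⟨u, hu, hfu⟩ := hf.contDiffOn (m := k) le_rfl (by simp)
  obtain ⟨s, hsu, hs, hxs⟩ := mem_nhds_iff.1 hu
  have hgs : IsOpen (g ⁻¹' s) := hs.preimage g.continuous
  have := g.iteratedFDerivWithin_comp_right (hfu.mono hsu) hs.uniqueDiffOn hgs.uniqueDiffOn hxs
    (i := k) le_rfl
  rw [iteratedFDerivWithin_of_isOpen k hs hxs, iteratedFDerivWithin_of_isOpen k hgs hxs] at this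
  exact this

/-- Faà di Bruno's formula along a curve, as a sum over set partitions. -/
theorem iteratedDeriv_comp_eq_sum {E F : Type*} [NormedAddCommGroup E] [NormedSpace ℝ E]
    [NormedAddCommGroup F] [NormedSpace ℝ F] {H : E → F} {γ : ℝ → E} {a : ℝ} {n : ℕ}
    (hH : ContDiffAt ℝ n H (γ a)) (hγ : ContDiffAt ℝ n γ a) :
    iteratedDeriv n (fun t => H (γ t)) a = ∑ c : OrderedFinpartition n,
      iteratedFDeriv ℝ c.length H (γ a) fun i => iteratedDeriv (c.partSize i) γ a := by
  rw [iteratedDeriv_eq_iteratedFDeriv]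
  have := iteratedFDeriv_comp hH hγ (i := n) le_rfl
  change iteratedFDeriv ℝ n (fun t => H (γ t)) a = _ at this
  rw [this, FormalMultilinearSeries.taylorComp, _root_.sum_apply]
  refine Finset.sum_congr rfl fun c _ => ?_
  rw [FormalMultilinearSeries.compAlongOrderedFinpartition_apply]
  rfl

end IteratedDerivatives

section Symmetric

theorem exists_perm_of_map_univ_eq {α ι : Type*} [Fintype α] {s r : α → ι}
    (h : Multiset.map s Finset.univ.val = Multiset.map r Finset.univ.val) :
    ∃ σ : Equiv.Perm α, ∀ a, s (σ a) = r a := by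
  classical
  have hc : ∀ i, Fintype.card {a // r a = i} = Fintype.card {a // s a = i} := by
    intro i
    have := congrArg (Multiset.count i) h
    rw [Multiset.count_map, Multiset.count_map] at this
    rw [Fintype.card_subtype, Fintype.card_subtype, Finset.card, Finset.card, Finset.filter_val,
      Finset.filter_val]
    simpa [eq_comm] using this.symm
  exact ⟨Equiv.ofFiberEquiv fun i => Fintype.equivOfCardEq (hc i),
    fun a => Equiv.ofFiberEquiv_map _ a⟩

/-- Evaluation of a multilinear form at linear combinations of given vectors. -/
noncomputable def MultilinearMap.onCoordinates {V : Type*} [AddCommGroup V] [Module ℝ V] {k : ℕ}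
    {ι : Type*} [Fintype ι] [DecidableEq ι]
    (D : MultilinearMap ℝ (fun _ : Fin k => V) ℝ) (v : ι → V) : (ι → ℝ) [×k]→L[ℝ] ℝ :=
  ∑ r : Fin k → ι, D (fun j => v (r j)) •
    (ContinuousMultilinearMap.mkPiAlgebra ℝ (Fin k) ℝ).compContinuousLinearMap
      fun j => ContinuousLinearMap.proj (r j)

theorem MultilinearMap.onCoordinates_apply {V : Type*} [AddCommGroup V] [Module ℝ V] {k : ℕ}
    {ι : Type*} [Fintype ι] [DecidableEq ι]
    (D : MultilinearMap ℝ (fun _ : Fin k => V) ℝ) (v : ι → V) (b : Fin k → ι → ℝ) :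
    D.onCoordinates v b = D fun j => ∑ i, b j i • v i := by
  rw [MultilinearMap.map_sum]
  simp only [MultilinearMap.onCoordinates, _root_.sum_apply,
    _root_.smul_apply, ContinuousMultilinearMap.compContinuousLinearMap_apply,
    ContinuousMultilinearMap.mkPiAlgebra_apply, ContinuousLinearMap.proj_apply]
  refine Finset.sum_congr rfl fun r _ => ?_
  rw [MultilinearMap.map_smul_univ, smul_eq_mul, smul_eq_mul, mul_comm]

/-- A symmetric multilinear form is determined by its values on the diagonal. -/
theorem MultilinearMap.ext_of_diagonal {V : Type*} [AddCommGroup V] [Module ℝ V] {k : ℕ}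
    {D D' : MultilinearMap ℝ (fun _ : Fin k => V) ℝ}
    (hD : ∀ (σ : Equiv.Perm (Fin k)) (v : Fin k → V), D (fun i => v (σ i)) = D v)
    (hD' : ∀ (σ : Equiv.Perm (Fin k)) (v : Fin k → V), D' (fun i => v (σ i)) = D' v)
    (h : ∀ x, D (fun _ => x) = D' fun _ => x) : D = D' := by
  ext v
  have key : ∀ D : MultilinearMap ℝ (fun _ : Fin k => V) ℝ,
      (∀ (σ : Equiv.Perm (Fin k)) (v : Fin k → V), D (fun i => v (σ i)) = D v) →
      iteratedFDeriv ℝ k (fun a : Fin k → ℝ => D fun _ => ∑ i, a i • v i) 0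
        (fun i => Pi.single i 1) = k ! * D v := by
    intro D hD
    have h1 := ContinuousMultilinearMap.iteratedFDeriv_comp_diagonal (D.onCoordinates v) 0
      (fun i => Pi.single i 1)
    simp only [MultilinearMap.onCoordinates_apply] at h1
    rw [h1]
    have h2 : ∀ σ : Equiv.Perm (Fin k),
        (D fun j => ∑ i, (Pi.single (σ j) (1 : ℝ) : Fin k → ℝ) i • v i) = D v := by
      intro σ
      rw [← hD σ v]
      congr 1
      funext j
      simp [Pi.single_apply]
    rw [Finset.sum_congr rfl fun σ _ => h2 σ]
    simp [Fintype.card_perm]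
  have h1 := key D hD
  simp only [h] at h1
  rw [key D' hD'] at h1
  exact (mul_left_cancel₀ (by positivity) h1).symm

end Symmetric

section SmoothOnSubspaces

variable {V : Type*} [AddCommGroup V] [Module ℝ V]

/-- The `k`-th derivative at `0` of a function which is smooth on finite-dimensional subspaces. -/
noncomputable def subspaceDeriv (g : V → ℝ) (k : ℕ) (v : Fin k → V) : ℝ :=
  iteratedFDeriv ℝ k (fun a : Fin k → ℝ => g (∑ i, a i • v i)) 0 fun i => Pi.single i 1

/-- `g` is of class `C^k` at `0` on every finite-dimensional subspace. -/
def ContDiffOnSubspaces (g : V → ℝ) (k : ℕ) : Prop :=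
  ∀ (m : ℕ) (w : Fin m → V), ContDiffAt ℝ k (fun a : Fin m → ℝ => g (∑ i, a i • w i)) 0

variable {g : V → ℝ} {k : ℕ}

theorem iteratedFDeriv_eq_subspaceDeriv (hg : ContDiffOnSubspaces g k)
    {m : ℕ} (w : Fin m → V) (b : Fin k → Fin m → ℝ) :
    iteratedFDeriv ℝ k (fun a : Fin m → ℝ => g (∑ i, a i • w i)) 0 b =
      subspaceDeriv g k fun i => ∑ j, b i j • w j := by
  let B : (Fin k → ℝ) →L[ℝ] (Fin m → ℝ) :=
    ∑ i, (ContinuousLinearMap.proj i : (Fin k → ℝ) →L[ℝ] ℝ).smulRight (b i)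
  have hB : ∀ c, B c = ∑ i, c i • b i := fun c => by simp [B]
  have h1 : (fun c : Fin k → ℝ => g (∑ i, c i • ∑ j, b i j • w j)) =
      fun c => (fun a : Fin m → ℝ => g (∑ i, a i • w i)) (B c) := by
    funext c
    simp only [hB, Finset.sum_apply, Pi.smul_apply, smul_eq_mul, Finset.sum_smul, Finset.smul_sum,
      smul_smul]
    rw [Finset.sum_comm]
  have h2 := ContDiffAt.iteratedFDeriv_comp_continuousLinearMap B (x := 0)
    (f := fun a : Fin m → ℝ => g (∑ i, a i • w i)) (k := k) (by rw [map_zero]; exact hg m w)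
  rw [subspaceDeriv, h1, h2, map_zero, ContinuousMultilinearMap.compContinuousLinearMap_apply]
  congr 1
  funext i
  rw [hB]
  simp [Pi.single_apply]

theorem subspaceDeriv_perm (hg : ContDiffOnSubspaces g k)
    (σ : Equiv.Perm (Fin k)) (v : Fin k → V) :
    subspaceDeriv g k (fun i => v (σ i)) = subspaceDeriv g k v := by
  have h1 := iteratedFDeriv_eq_subspaceDeriv hg v (fun i => Pi.single (σ i) 1)
  have h2 := (hg k v).iteratedFDeriv_perm k σ (fun i => Pi.single i 1)
  have h3 : (fun i => ∑ j, (Pi.single (σ i) (1 : ℝ) : Fin k → ℝ) j • v j) = fun i => v (σ i) := by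
    funext i
    simp [Pi.single_apply]
  rw [h3] at h1
  rw [← h1, h2, subspaceDeriv]

/-- The `k`-th derivative at `0` is a multilinear form. -/
theorem exists_multilinearMap_subspaceDeriv (hg : ContDiffOnSubspaces g k) :
    ∃ D : MultilinearMap ℝ (fun _ : Fin k => V) ℝ, ∀ v, D v = subspaceDeriv g k v := by
  have key : ∀ (v : Fin k → V) (x y : V), ∃ M : (Fin (k + 2) → ℝ) [×k]→L[ℝ] ℝ,
      ∃ e : Fin k → Fin (k + 2) → ℝ, ∃ ex ey : Fin (k + 2) → ℝ, ∀ (i : Fin k) (r s : ℝ),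
        M (Function.update e i (r • ex + s • ey)) =
          subspaceDeriv g k (Function.update v i (r • x + s • y)) := by
    intro v x y
    let w : Fin (k + 2) → V := Fin.cons x (Fin.cons y v : Fin (k + 1) → V)
    refine ⟨iteratedFDeriv ℝ k (fun a : Fin (k + 2) → ℝ => g (∑ i, a i • w i)) 0,
      fun i => Pi.single i.succ.succ 1, Pi.single 0 1, Pi.single 1 1, fun i r s => ?_⟩
    · rw [iteratedFDeriv_eq_subspaceDeriv hg w]
      congr 1
      funext j
      rcases eq_or_ne j i with rfl | hj
      · simp [w, Fin.sum_univ_succ, Pi.single_apply, Fin.succ_succ_ne_one]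
      · simp [w, Function.update_of_ne hj, Pi.single_apply]
  refine ⟨MultilinearMap.mk' (subspaceDeriv g k) (fun v i x y => ?_) (fun v i c x => ?_),
    fun v => rfl⟩
  · obtain ⟨M, e, ex, ey, h⟩ := key v x y
    have h1 := h i 1 1
    have h2 := h i 1 0
    have h3 := h i 0 1
    simp only [one_smul, zero_smul, add_zero, zero_add] at h1 h2 h3
    rw [← h1, ← h2, ← h3, M.map_update_add]
  · obtain ⟨M, e, ex, ey, h⟩ := key v x x
    have h1 := h i c 0
    have h2 := h i 1 0
    simp only [one_smul, zero_smul, add_zero] at h1 h2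
    rw [← h1, ← h2, M.map_update_smul]

theorem subspaceDeriv_diagonal (hg : ContDiffOnSubspaces g k)
    (x : V) :
    subspaceDeriv g k (fun _ => x) = iteratedDeriv k (fun h : ℝ => g (h • x)) 0 := by
  have h1 := iteratedFDeriv_eq_subspaceDeriv hg (fun _ : Fin 1 => x) (fun _ _ => 1)
  simp only [Finset.univ_unique, Finset.sum_const, Finset.card_singleton, one_smul] at h1
  rw [← h1, iteratedDeriv_eq_iteratedFDeriv]
  let A : ℝ →L[ℝ] (Fin 1 → ℝ) := ContinuousLinearMap.pi fun _ => ContinuousLinearMap.id ℝ ℝ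
  have h2 := ContDiffAt.iteratedFDeriv_comp_continuousLinearMap A (x := 0)
    (f := fun a : Fin 1 → ℝ => g (∑ i, a i • x)) (k := k)
    (by rw [map_zero]; exact hg 1 fun _ => x)
  have h3 : (fun h : ℝ => g (h • x)) =
      fun h => (fun a : Fin 1 → ℝ => g (∑ i, a i • x)) (A h) := by
    funext h
    simp [A]
  rw [h3, h2, map_zero]
  rfl

end SmoothOnSubspaces

section Superposition

universe u
variable {K : Type*} [TopologicalSpace K] [CompactSpace K]
  {E F : Type u} [NormedAddCommGroup E] [NormedSpace ℝ E] [NormedAddCommGroup F] [NormedSpace ℝ F]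

/-- Pointwise application of a continuous family of operators to a continuous family of vectors. -/
noncomputable def ContinuousMap.applyCLM (K : Type*) [TopologicalSpace K] [CompactSpace K]
    (E F : Type u) [NormedAddCommGroup E] [NormedSpace ℝ E] [NormedAddCommGroup F]
    [NormedSpace ℝ F] : C(K, E →L[ℝ] F) →L[ℝ] C(K, E) →L[ℝ] C(K, F) :=
  LinearMap.mkContinuous₂
    (LinearMap.mk₂ ℝ
      (fun (M : C(K, E →L[ℝ] F)) (h : C(K, E)) =>
        (⟨fun s => M s (h s), M.continuous.clm_apply h.continuous⟩ : C(K, F)))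
      (fun _ _ _ => by ext; simp) (fun _ _ _ => by ext; simp)
      (fun _ _ _ => by ext; simp) (fun _ _ _ => by ext; simp))
    1 (fun M h => by
      rw [one_mul, ContinuousMap.norm_le _ (by positivity)]
      intro s
      exact (M s).le_of_opNorm_le_of_le (M.norm_coe_le_norm s) (h.norm_coe_le_norm s))

/-- The superposition operator of a `C^1` map is differentiable. -/
theorem ContDiff.hasFDerivAt_superposition {g : E → F} (hg : ContDiff ℝ 1 g) (γ : C(K, E)) :
    HasFDerivAt (fun γ : C(K, E) => (⟨g, hg.continuous⟩ : C(E, F)).comp γ)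
      (ContinuousMap.applyCLM K E F
        ((⟨fderiv ℝ g, hg.continuous_fderiv (by simp)⟩ : C(E, E →L[ℝ] F)).comp γ)) γ := by
  rw [hasFDerivAt_iff_isLittleO_nhds_zero, Asymptotics.isLittleO_iff]
  intro ε hε
  obtain ⟨G, hG⟩ : ∃ G : C(E, E →L[ℝ] F), G = ⟨fderiv ℝ g, hg.continuous_fderiv (by simp)⟩ :=
    ⟨_, rfl⟩
  have hcont : Filter.Tendsto (fun γ' : C(K, E) => G.comp γ') (𝓝 γ) (𝓝 (G.comp γ)) :=
    (ContinuousMap.continuous_postcomp G).continuousAt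
  have hc := hcont.eventually (Metric.ball_mem_nhds (G.comp γ) hε)
  obtain ⟨δ, hδ, H⟩ := Metric.eventually_nhds_iff.1 hc
  filter_upwards [Metric.ball_mem_nhds (0 : C(K, E)) hδ] with h hh
  rw [ContinuousMap.norm_le _ (by positivity)]
  intro s
  have hball : ∀ y ∈ Metric.ball (γ s) δ, ‖fderiv ℝ g y - fderiv ℝ g (γ s)‖ ≤ ε := by
    intro y hy
    have h1 : Dist.dist (γ + ContinuousMap.const K (y - γ s)) γ < δ := by
      rw [dist_eq_norm, add_sub_cancel_left]
      refine lt_of_le_of_lt ((ContinuousMap.norm_le _ (norm_nonneg _)).2 fun _ => le_rfl) ?_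
      exact mem_ball_iff_norm.1 hy
    have h2 := (ContinuousMap.dist_apply_le_dist s).trans (Metric.mem_ball.1 (H h1)).le
    rw [dist_eq_norm] at h2
    simpa [hG] using h2
  have hs : ‖h s‖ < δ := (h.norm_coe_le_norm s).trans_lt (by simpa using hh)
  have h3 := (convex_ball (γ s) δ).norm_image_sub_le_of_norm_fderiv_le'
    (f := g) (fun y _ => (hg.differentiable (by simp)).differentiableAt) hball
    (Metric.mem_ball_self hδ) (y := γ s + h s) (by simpa using hs)
  simp only [add_sub_cancel_left] at h3
  exact h3.trans (by gcongr; exact h.norm_coe_le_norm s)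

theorem ContDiff.superposition_nat (n : ℕ) : ∀ {F : Type u} [NormedAddCommGroup F]
    [NormedSpace ℝ F] {g : E → F} (hg : ContDiff ℝ n g),
    ContDiff ℝ n (fun γ : C(K, E) => (⟨g, hg.continuous⟩ : C(E, F)).comp γ) := by
  induction n with
  | zero =>
    intro F _ _ g hg
    simp only [Nat.cast_zero, contDiff_zero]
    exact ContinuousMap.continuous_postcomp _
  | succ n ih =>
    intro F _ _ g hg
    have hg' : ContDiff ℝ n (fderiv ℝ g) := hg.fderiv_right (by push_cast; rfl)
    push_cast
    rw [contDiff_succ_iff_hasFDerivAt]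
    refine ⟨_, (ContinuousMap.applyCLM K E F).contDiff.comp (ih hg'), fun γ => ?_⟩
    exact (hg.of_le (by norm_cast; omega)).hasFDerivAt_superposition γ

/-- The superposition operator of a smooth map is smooth. -/
theorem ContDiff.superposition {g : E → F} (hg : ContDiff ℝ ∞ g) :
    ContDiff ℝ ∞ (fun γ : C(K, E) => (⟨g, hg.continuous⟩ : C(E, F)).comp γ) :=
  contDiff_infty.2 fun n => ContDiff.superposition_nat n (hg.of_le (by exact_mod_cast le_top))

end Superposition

section FixedPoint

variable {P X : Type*} [NormedAddCommGroup P] [NormedSpace ℝ P] [CompleteSpace P]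
  [NormedAddCommGroup X] [NormedSpace ℝ X] [CompleteSpace X]

/-- Fixed points of a smooth family of uniform contractions depend smoothly on the parameter. -/
theorem contDiff_fixedPoint {f : P × X → X} (hf : ContDiff ℝ ∞ f) {κ : ℝ≥0} (hκ : κ < 1)
    (hL : ∀ p, LipschitzWith κ fun x => f (p, x)) {u : P → X} (hu : ∀ p, f (p, u p) = u p) :
    ContDiff ℝ ∞ u := by
  rw [contDiff_iff_contDiffAt]
  intro p
  set q : P × X → X := fun z => z.2 - f z with hq
  have hqs : ContDiff ℝ ∞ q := contDiff_snd.sub hf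
  have hinv : (fderiv ℝ q (p, u p) ∘L .inr ℝ P X).IsInvertible := by
    have hd : HasFDerivAt f (fderiv ℝ f (p, u p)) (p, u p) :=
      (hf.differentiable (by simp)).differentiableAt.hasFDerivAt
    have h1 : HasFDerivAt (fun x => f (p, x)) (fderiv ℝ f (p, u p) ∘L .inr ℝ P X) (u p) :=
      hd.comp (u p) (hasFDerivAt_prodMk_right p (u p))
    have h2 : ‖fderiv ℝ f (p, u p) ∘L .inr ℝ P X‖ < 1 := by
      have := h1.le_of_lipschitz (hL p)
      exact lt_of_le_of_lt this (by exact_mod_cast hκ)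
    have h3 : fderiv ℝ q (p, u p) ∘L .inr ℝ P X = 1 - fderiv ℝ f (p, u p) ∘L .inr ℝ P X := by
      have : HasFDerivAt q (ContinuousLinearMap.snd ℝ P X - fderiv ℝ f (p, u p)) (p, u p) :=
        hasFDerivAt_snd.sub hd
      rw [this.fderiv]
      ext x
      simp
    rw [h3]
    obtain ⟨w, hw⟩ := isUnit_one_sub_of_norm_lt_one h2
    exact ⟨ContinuousLinearEquiv.unitsEquiv ℝ X w, by rw [← hw]; rfl⟩
  have hc : ContDiffAt ℝ ∞ q (p, u p) := hqs.contDiffAt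
  refine (hc.contDiffAt_implicitFunction (by simp) hinv).congr_of_eventuallyEq ?_
  filter_upwards [hc.eventually_apply_implicitFunction (by simp) hinv] with a ha
  set w := hc.implicitFunction (by simp) hinv a
  have h0 : q (p, u p) = 0 := by simp [hq, hu p]
  rw [h0, hq, sub_eq_zero] at ha
  have h4 := (hL a).dist_le_mul (u a) w
  rw [hu a, ← ha] at h4
  have h5 : (κ : ℝ) < 1 := by exact_mod_cast hκ
  have h6 : dist (u a) w ≤ 0 := by nlinarith [dist_nonneg (x := u a) (y := w)]
  exact dist_le_zero.1 h6

theorem exists_contDiff_fixedPoint {f : P × X → X} (hf : ContDiff ℝ ∞ f) {κ : ℝ≥0} (hκ : κ < 1)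
    (hL : ∀ p, LipschitzWith κ fun x => f (p, x)) :
    ∃ u : P → X, ContDiff ℝ ∞ u ∧ (∀ p, f (p, u p) = u p) ∧ ∀ p x, f (p, x) = x → x = u p := by
  have hc : ∀ p, ContractingWith κ fun x => f (p, x) := fun p => ⟨hκ, hL p⟩
  have hfix : ∀ p, f (p, (hc p).fixedPoint _) = (hc p).fixedPoint _ :=
    fun p => (hc p).fixedPoint_isFixedPt
  exact ⟨fun p => (hc p).fixedPoint _, contDiff_fixedPoint hf hκ hL hfix, hfix,
    fun p x hx => (hc p).fixedPoint_unique hx⟩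

/-- A smooth family of maps `id + f_p`, with the `f_p` uniformly contracting, is a family of
bijections, whose inverses depend smoothly on the parameter. -/
theorem exists_contDiff_inverse {f : P × X → X} (hf : ContDiff ℝ ∞ f) {κ : ℝ≥0} (hκ : κ < 1)
    (hL : ∀ p, LipschitzWith κ fun x => f (p, x)) :
    ∃ Y : P × X → X, ContDiff ℝ ∞ Y ∧ (∀ p y, Y (p, y) + f (p, Y (p, y)) = y) ∧
      ∀ p x, Y (p, x + f (p, x)) = x := by
  obtain ⟨u, hu, h1, h2⟩ := exists_contDiff_fixedPoint (P := P × X) (X := X)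
    (f := fun z => z.1.2 - f (z.1.1, z.2)) (by fun_prop) hκ
    (fun p => by
      have := hL p.1
      refine LipschitzWith.of_dist_le_mul fun x y => ?_
      simpa [dist_eq_norm, norm_sub_rev] using this.dist_le_mul y x)
  refine ⟨u, hu, fun p y => ?_, fun p x => ?_⟩
  · have := h1 (p, y)
    simp only at this
    nth_rewrite 1 [← this]
    abel
  · exact (h2 (p, x + f (p, x)) x (by simp)).symm

end FixedPoint

section Flow

/-- A bounded smooth function of the real line which is the identity near `0`. -/
theorem exists_contDiff_truncation {ε : ℝ} (hε : 0 < ε) :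
    ∃ ρ : ℝ → ℝ, ContDiff ℝ ∞ ρ ∧ (∀ h, |ρ h| ≤ ε) ∧ ∀ h, |h| ≤ ε / 2 → ρ h = h := by
  let ψ : ContDiffBump (0 : ℝ) := ⟨ε / 2, ε, half_pos hε, half_lt_self hε⟩
  refine ⟨fun h => h * ψ h, contDiff_id.mul ψ.contDiff, fun h => ?_, fun h hh => ?_⟩
  · rcases le_total ε |h| with h1 | h1
    · have : ψ h = 0 := ψ.zero_of_le_dist (by simpa [Real.dist_eq] using h1)
      simp [this, hε.le]
    · rw [abs_mul, abs_of_nonneg ψ.nonneg]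
      exact (mul_le_of_le_one_right (abs_nonneg _) ψ.le_one).trans h1
  · have : ψ h = 1 := ψ.one_of_mem_closedBall (by simpa [Real.dist_eq] using hh)
    simp [this]

variable {E : Type*} [NormedAddCommGroup E] [NormedSpace ℝ E]

theorem norm_integral_IccExtend_le (β : C(unitInterval, E)) (s : unitInterval) :
    ‖∫ σ in (0 : ℝ)..s, IccExtend zero_le_one β σ‖ ≤ ‖β‖ := by
  have h := intervalIntegral.norm_integral_le_of_norm_le_const (a := (0 : ℝ)) (b := s)
    (f := IccExtend zero_le_one β) (C := ‖β‖) fun σ _ => β.norm_coe_le_norm _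
  refine h.trans (mul_le_of_le_one_right (norm_nonneg _) ?_)
  rw [sub_zero, abs_of_nonneg s.2.1]
  exact s.2.2

/-- Integration of continuous curves from the left end point of the unit interval. -/
noncomputable def unitIntervalPrimitive (E : Type*) [NormedAddCommGroup E] [NormedSpace ℝ E] :
    C(unitInterval, E) →L[ℝ] C(unitInterval, E) :=
  have hc (β : C(unitInterval, E)) : Continuous (IccExtend zero_le_one β) :=
    β.continuous.Icc_extend'
  LinearMap.mkContinuous
    { toFun := fun β => ⟨fun s => ∫ σ in (0 : ℝ)..s, IccExtend zero_le_one β σ,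
        (intervalIntegral.continuous_primitive (fun a b => (hc β).intervalIntegrable a b) 0).comp
          continuous_subtype_val⟩
      map_add' := fun β γ => by
        ext s
        exact intervalIntegral.integral_add ((hc β).intervalIntegrable _ _)
          ((hc γ).intervalIntegrable _ _)
      map_smul' := fun c β => by
        ext s
        exact intervalIntegral.integral_smul c _ }
    1 (fun β => by
      rw [one_mul, ContinuousMap.norm_le _ (norm_nonneg _)]
      exact norm_integral_IccExtend_le β)

theorem unitIntervalPrimitive_apply (β : C(unitInterval, E)) (s : unitInterval) :
    unitIntervalPrimitive E β s = ∫ σ in (0 : ℝ)..s, IccExtend zero_le_one β σ := rfl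

theorem norm_unitIntervalPrimitive_le (β : C(unitInterval, E)) :
    ‖unitIntervalPrimitive E β‖ ≤ ‖β‖ :=
  (ContinuousMap.norm_le _ (norm_nonneg _)).2 (norm_integral_IccExtend_le β)

/-- The Picard operator of the rescaled field `(s, x) ↦ r • V (r * s, x)`, `r = ρ h`, is smooth
jointly in the scale and the curve. -/
theorem exists_contDiff_picard {V : ℝ × E → E} (hV : ContDiff ℝ ∞ V) {L : ℝ≥0}
    (hL : ∀ t, LipschitzWith L fun x => V (t, x)) {ρ : ℝ → ℝ} (hρ : ContDiff ℝ ∞ ρ) {ε : ℝ}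
    (hρε : ∀ h, |ρ h| ≤ ε) :
    ∃ Q : ℝ × C(unitInterval, E) → C(unitInterval, E), ContDiff ℝ ∞ Q ∧
      (∀ h γ γ', ‖Q (h, γ) - Q (h, γ')‖ ≤ ε * L * ‖γ - γ'‖) ∧
      ∀ h γ (s : unitInterval), Q (h, γ) s =
        ∫ σ in (0 : ℝ)..s, ρ h • V (ρ h * σ, IccExtend zero_le_one γ σ) := by
  have hε : 0 ≤ ε := (abs_nonneg _).trans (hρε 0)
  let g : ℝ × ℝ × E → E := fun z => ρ z.1 • V (ρ z.1 * z.2.1, z.2.2)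
  have hg : ContDiff ℝ ∞ g := by fun_prop
  let m0 : C(unitInterval, ℝ × ℝ × E) := ⟨fun s => (0, (s : ℝ), 0), by fun_prop⟩
  let A : ℝ × C(unitInterval, E) → C(unitInterval, ℝ × ℝ × E) := fun z =>
    ContinuousLinearMap.const ℝ unitInterval (ContinuousLinearMap.inl ℝ ℝ (ℝ × E) z.1) + m0 +
      ((ContinuousLinearMap.inr ℝ ℝ (ℝ × E)).comp
        (ContinuousLinearMap.inr ℝ ℝ E)).compLeftContinuous ℝ unitInterval z.2
  have hA : ContDiff ℝ ∞ A := by fun_prop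
  have hAs : ∀ h γ s, A (h, γ) s = (h, (s : ℝ), γ s) := by
    intro h γ s
    simp [A, m0]
  let N : C(unitInterval, ℝ × ℝ × E) → C(unitInterval, E) := fun γ =>
    (⟨g, hg.continuous⟩ : C(ℝ × ℝ × E, E)).comp γ
  refine ⟨fun z => unitIntervalPrimitive E (N (A z)), ?_, fun h γ γ' => ?_, fun h γ s => ?_⟩
  · exact (unitIntervalPrimitive E).contDiff.comp (hg.superposition.comp hA)
  · rw [← map_sub]
    refine (norm_unitIntervalPrimitive_le _).trans ?_
    rw [ContinuousMap.norm_le _ (by positivity)]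
    intro s
    have h1 : (N (A (h, γ)) - N (A (h, γ'))) s =
        ρ h • (V (ρ h * s, γ s) - V (ρ h * s, γ' s)) := by
      change g (A (h, γ) s) - g (A (h, γ') s) = _
      rw [hAs, hAs, smul_sub]
    rw [h1, norm_smul, mul_assoc]
    gcongr
    · exact hρε h
    · refine ((hL _).norm_sub_le _ _).trans ?_
      gcongr
      exact (γ - γ').norm_coe_le_norm s
  · rw [unitIntervalPrimitive_apply]
    refine intervalIntegral.integral_congr fun σ hσ => ?_
    rw [uIcc_of_le s.2.1] at hσ
    have hσ' : σ ∈ Icc (0 : ℝ) 1 := ⟨hσ.1, hσ.2.trans s.2.2⟩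
    rw [IccExtend_of_mem _ _ hσ', IccExtend_of_mem _ _ hσ']
    change g (A (h, γ) _) = _
    rw [hAs]

/-- Flow of a smooth, globally Lipschitz, time-dependent field for short times. The maps and their
inverses are extended to all times as diffeomorphisms. -/
theorem exists_contDiff_flow [CompleteSpace E] {V : ℝ × E → E} (hV : ContDiff ℝ ∞ V) {L : ℝ≥0}
    (hL : ∀ t, LipschitzWith L fun x => V (t, x)) :
    ∃ δ > 0, ∃ X Y : ℝ → E → E, ContDiff ℝ ∞ (Function.uncurry X) ∧
      ContDiff ℝ ∞ (Function.uncurry Y) ∧ (∀ x, X 0 x = x) ∧ (∀ h x, Y h (X h x) = x) ∧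
      (∀ h x, X h (Y h x) = x) ∧ (∀ h, LipschitzWith 2 (X h)) ∧
      ∀ h, |h| < δ → ∀ x, HasDerivAt (fun s => X s x) (V (h, X h x)) h := by
  obtain ⟨ε, hε, hεL⟩ : ∃ ε : ℝ, 0 < ε ∧ ε * L ≤ 1 / 4 := by
    refine ⟨1 / (4 * (L + 1)), by positivity, ?_⟩
    rw [div_mul_eq_mul_div, div_le_div_iff₀ (by positivity) (by norm_num)]
    nlinarith [L.2]
  obtain ⟨ρ, hρ, hρε, hρid⟩ := exists_contDiff_truncation hε
  obtain ⟨Q, hQ, hQL, hQs⟩ := exists_contDiff_picard hV hL hρ hρε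
  have hQL' : ∀ h γ γ', ‖Q (h, γ) - Q (h, γ')‖ ≤ 1 / 4 * ‖γ - γ'‖ := fun h γ γ' =>
    (hQL h γ γ').trans (by gcongr)
  obtain ⟨u, hu, hfix, huniq⟩ := exists_contDiff_fixedPoint (P := ℝ × E) (X := C(unitInterval, E))
    (f := fun z => ContinuousLinearMap.const ℝ unitInterval z.1.2 + Q (z.1.1, z.2))
    (by fun_prop) (κ := 1 / 4) (by norm_num) (fun p => by
      refine LipschitzWith.of_dist_le_mul fun γ γ' => ?_
      rw [dist_eq_norm, dist_eq_norm, add_sub_add_left_eq_sub]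
      simpa using hQL' p.1 γ γ')
  simp only [Prod.forall] at hfix huniq
  let X : ℝ → E → E := fun h x => u (h, x) 1
  have hXs : ContDiff ℝ ∞ (Function.uncurry X) :=
    (ContinuousMap.evalCLM (M := E) ℝ (1 : unitInterval)).contDiff.comp hu
  have hfix' : ∀ h x (s : unitInterval), u (h, x) s = x + Q (h, u (h, x)) s := by
    intro h x s
    nth_rewrite 1 [← hfix h x]
    simp
  have hlip : ∀ h x y, ‖u (h, x) - u (h, y)‖ ≤ 4 / 3 * ‖x - y‖ := by
    intro h x y
    have h1 : u (h, x) - u (h, y) = ContinuousLinearMap.const ℝ unitInterval (x - y) +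
        (Q (h, u (h, x)) - Q (h, u (h, y))) := by
      ext s
      simp only [ContinuousMap.sub_apply, ContinuousMap.add_apply]
      rw [hfix' h x s, hfix' h y s]
      simp
      abel
    have h2 : ‖ContinuousLinearMap.const ℝ unitInterval (x - y)‖ ≤ ‖x - y‖ :=
      (ContinuousMap.norm_le _ (norm_nonneg _)).2 fun _ => le_rfl
    have h3 := (norm_add_le _ _).trans (add_le_add h2 (hQL' h (u (h, x)) (u (h, y))))
    rw [← h1] at h3
    linarith
  have hXid : ∀ h, LipschitzWith (1 / 3) fun x => X h x - x := by
    intro h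
    refine LipschitzWith.of_dist_le_mul fun x y => ?_
    have h1 : X h x - x - (X h y - y) = (Q (h, u (h, x)) - Q (h, u (h, y))) 1 := by
      simp only [X, hfix' h x 1, hfix' h y 1, ContinuousMap.sub_apply]
      abel
    rw [dist_eq_norm, h1, dist_eq_norm]
    have h2 := (ContinuousMap.norm_coe_le_norm (Q (h, u (h, x)) - Q (h, u (h, y))) 1).trans
      (hQL' h (u (h, x)) (u (h, y)))
    rw [ContinuousMap.coe_sub] at h2 ⊢
    have h3 := hlip h x y
    push_cast
    linarith
  obtain ⟨Y, hY, hXY, hYX⟩ := exists_contDiff_inverse (P := ℝ) (X := E)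
    (f := fun z => X z.1 z.2 - z.2) (hXs.sub contDiff_snd) (κ := 1 / 3)
    (by rw [div_lt_one (by norm_num)]; norm_num) hXid
  have hscale : ∀ h x (s : unitInterval), |h| ≤ ε / 2 → X (h * s) x = u (h, x) s := by
    intro h x s hh
    have hhs : |h * s| ≤ ε / 2 := by
      rw [abs_mul, abs_of_nonneg s.2.1]
      exact (mul_le_of_le_one_right (abs_nonneg _) s.2.2).trans hh
    let γ : C(unitInterval, E) := ⟨fun r => u (h, x) (s * r), by fun_prop⟩
    have hγ : γ = u (h * s, x) := by
      refine huniq (h * s) x γ ?_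
      ext r
      have h1 : γ r = x + Q (h, u (h, x)) (s * r) := hfix' h x (s * r)
      rw [h1]
      simp only [ContinuousMap.add_apply]
      rw [hQs, hQs, hρid _ hh, hρid _ hhs]
      congr 1
      have h2 := intervalIntegral.smul_integral_comp_mul_left (a := (0 : ℝ)) (b := r)
        (fun σ => h • V (h * σ, IccExtend zero_le_one (u (h, x)) σ)) (s : ℝ)
      rw [mul_zero] at h2
      rw [Icc.coe_mul, ← h2, ← intervalIntegral.integral_smul]
      refine intervalIntegral.integral_congr fun σ hσ => ?_
      rw [uIcc_of_le r.2.1] at hσ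
      have hσ' : σ ∈ Icc (0 : ℝ) 1 := ⟨hσ.1, hσ.2.trans r.2.2⟩
      have hsσ : (s : ℝ) * σ ∈ Icc (0 : ℝ) 1 := (s * ⟨σ, hσ'⟩ : unitInterval).2
      rw [IccExtend_of_mem _ _ hσ', IccExtend_of_mem _ _ hsσ, smul_smul, mul_comm (s : ℝ) h,
        mul_assoc]
      rfl
    change u (h * s, x) 1 = _
    rw [← hγ]
    change u (h, x) (s * 1) = _
    rw [mul_one]
  have hint : ∀ h x, |h| ≤ ε / 2 → X h x = x + ∫ τ in (0 : ℝ)..h, V (τ, X τ x) := by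
    intro h x hh
    have h1 : X h x = x + Q (h, u (h, x)) 1 := hfix' h x 1
    rw [h1, hQs, hρid _ hh]
    congr 1
    have h2 := intervalIntegral.smul_integral_comp_mul_left (a := (0 : ℝ)) (b := 1)
      (fun τ => V (τ, X τ x)) h
    rw [mul_zero, mul_one] at h2
    rw [← h2, ← intervalIntegral.integral_smul]
    refine intervalIntegral.integral_congr fun σ hσ => ?_
    rw [Icc.coe_one, uIcc_of_le zero_le_one] at hσ
    rw [IccExtend_of_mem _ _ hσ, ← hscale h x ⟨σ, hσ⟩ hh]
  refine ⟨ε / 2, half_pos hε, X, fun h x => Y (h, x), hXs, hY, fun x => ?_, fun h x => ?_,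
    fun h x => ?_, fun h => ?_, fun h hh x => ?_⟩
  · rw [hint 0 x (by simpa using (half_pos hε).le)]
    simp
  · simpa using hYX h x
  · simpa using hXY h x
  · refine LipschitzWith.of_dist_le_mul fun x y => ?_
    rw [dist_eq_norm, dist_eq_norm]
    have h2 := (ContinuousMap.norm_coe_le_norm (u (h, x) - u (h, y)) 1).trans (hlip h x y)
    refine h2.trans ?_
    push_cast
    nlinarith [norm_nonneg (x - y)]
  · have hcont : Continuous fun τ => V (τ, X τ x) :=
      hV.continuous.comp (continuous_id.prodMk
        (hXs.continuous.comp (continuous_id.prodMk continuous_const)))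
    have h1 : HasDerivAt (fun s => x + ∫ τ in (0 : ℝ)..s, V (τ, X τ x)) (V (h, X h x)) h :=
      (intervalIntegral.integral_hasDerivAt_right (hcont.intervalIntegrable _ _)
        hcont.stronglyMeasurable.stronglyMeasurableAtFilter hcont.continuousAt).const_add x
    refine h1.congr_of_eventuallyEq ?_
    filter_upwards [(isOpen_lt continuous_abs continuous_const).mem_nhds hh] with s hs
    exact hint s x (le_of_lt hs)

end Flow

section TestFunctions

/-- Finite measures on a finite-dimensional space that agree on smooth compactly supported
functions are equal. -/
theorem MeasureTheory.Measure.ext_of_integral_contDiff {E : Type*} [NormedAddCommGroup E]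
    [NormedSpace ℝ E] [FiniteDimensional ℝ E] [MeasurableSpace E] [BorelSpace E]
    {μ ν : Measure E} [IsProbabilityMeasure μ] [IsProbabilityMeasure ν]
    (h : ∀ f : E → ℝ, ContDiff ℝ ∞ f → HasCompactSupport f → ∫ x, f x ∂μ = ∫ x, f x ∂ν) :
    μ = ν := by
  have : ProperSpace E := FiniteDimensional.proper ℝ E
  refine Measure.ext_of_integral_eq_on_compactlySupported fun f => ?_
  refine eq_of_forall_dist_le fun ε hε => ?_
  have hfc : Continuous (f : E → ℝ) := f.continuous
  have hf : UniformContinuous f := f.hasCompactSupport.uniformContinuous_of_continuous hfc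
  obtain ⟨δ, hδ, hfδ⟩ := Metric.uniformContinuous_iff.1 hf (ε / 2) (half_pos hε)
  obtain ⟨g, hg, hgf⟩ := hfc.exists_contDiff_dist_le_of_forall_mem_ball_dist_le hδ
  have hgs : HasCompactSupport g := by
    refine HasCompactSupport.intro (f.hasCompactSupport.isCompact.cthickening (r := δ)) ?_
    intro x hx
    have hz : ∀ y ∈ Metric.ball x δ, f y = 0 := by
      intro y hy
      by_contra hne
      exact hx (Metric.mem_cthickening_of_dist_le x y δ _ (subset_tsupport _ hne)
        (by rw [dist_comm]; exact (Metric.mem_ball.1 hy).le))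
    have := hgf x 0 fun y hy => by rw [hz y hy, hz x (Metric.mem_ball_self hδ), dist_self]
    rw [dist_le_zero.1 this, hz x (Metric.mem_ball_self hδ)]
  have hdist : ∀ x, dist (g x) (f x) ≤ ε / 2 := fun x =>
    hgf x _ fun y hy => (hfδ (Metric.mem_ball.1 hy)).le
  have key : ∀ (ρ : Measure E) [IsProbabilityMeasure ρ],
      ‖∫ x, g x ∂ρ - ∫ x, f x ∂ρ‖ ≤ ε / 2 := by
    intro ρ _
    rw [← integral_sub (hg.continuous.integrable_of_hasCompactSupport hgs)
      (hfc.integrable_of_hasCompactSupport f.hasCompactSupport)]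
    have := norm_integral_le_of_norm_le_const (μ := ρ) (f := fun x => g x - f x) (C := ε / 2)
      (ae_of_all _ fun x => by rw [← dist_eq_norm]; exact hdist x)
    simpa using this
  have h1 := key μ
  have h2 := key ν
  rw [h g hg hgs] at h1
  rw [Real.norm_eq_abs, abs_le] at h1 h2
  rw [Real.dist_eq, abs_le]
  constructor <;> linarith

/-- **du Bois-Reymond lemma**: a continuous function on an interval with vanishing distributional
derivative is constant. -/
theorem eq_of_forall_integral_deriv_mul_eq_zero {δ : ℝ} (hδ : 0 < δ) {f : ℝ → ℝ}
    (hf : ContinuousOn f (Ioo (-δ) δ))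
    (h : ∀ θ : ℝ → ℝ, ContDiff ℝ ∞ θ → HasCompactSupport θ → tsupport θ ⊆ Ioo (-δ) δ →
      ∫ t, deriv θ t * f t = 0) {t : ℝ} (ht : t ∈ Ioo (-δ) δ) : f t = f 0 := by
  have hint : ∀ g : ℝ → ℝ, ContDiff ℝ ∞ g → HasCompactSupport g → tsupport g ⊆ Ioo (-δ) δ →
      Integrable fun t => g t * f t := by
    intro g hg hgs hgt
    refine Continuous.integrable_of_hasCompactSupport ?_ hgs.mul_right
    rw [continuous_iff_continuousAt]
    intro t
    by_cases ht : t ∈ tsupport g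
    · exact hg.continuous.continuousAt.mul (hf.continuousAt (isOpen_Ioo.mem_nhds (hgt ht)))
    · have : (fun t => g t * f t) =ᶠ[𝓝 t] fun _ => 0 := by
        filter_upwards [(isClosed_tsupport g).isOpen_compl.mem_nhds ht] with s hs
        rw [image_eq_zero_of_notMem_tsupport hs, zero_mul]
      exact continuousAt_const.congr this.symm
  let ψ : ContDiffBump (0 : ℝ) := ⟨δ / 4, δ / 2, by linarith, by linarith⟩
  have hψs : ContDiff ℝ ∞ (ψ.normed volume) := ψ.contDiff_normed
  have hψc : HasCompactSupport (ψ.normed volume) := ψ.hasCompactSupport_normed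
  have hψt : tsupport (ψ.normed volume) ⊆ Ioo (-δ) δ := by
    rw [ψ.tsupport_normed_eq, Real.closedBall_eq_Icc]
    intro x hx
    have h1 : ψ.rOut = δ / 2 := rfl
    rw [h1] at hx
    exact ⟨by linarith [hx.1], by linarith [hx.2]⟩
  have hψi : ∫ x, ψ.normed volume x = 1 := ψ.integral_normed
  have hzero : ∀ ζ : ℝ → ℝ, ContDiff ℝ ∞ ζ → HasCompactSupport ζ → tsupport ζ ⊆ Ioo (-δ) δ →
      ∫ x, ζ x = 0 → ∫ x, ζ x * f x = 0 := by
    intro ζ hζ hζc hζt hζ0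
    obtain ⟨r, hrδ, hr0, hr⟩ : ∃ r < δ, 0 ≤ r ∧ tsupport ζ ⊆ Icc (-r) r := by
      rcases (tsupport ζ).eq_empty_or_nonempty with he | hne
      · exact ⟨0, hδ, le_rfl, by simp [he]⟩
      · obtain ⟨x, hx, hmax⟩ := hζc.isCompact.exists_isMaxOn hne continuous_abs.continuousOn
        exact ⟨|x|, abs_lt.2 (hζt hx), abs_nonneg x, fun y hy => abs_le.1 (hmax hy)⟩
    have hz : ∀ x, x ∉ Icc (-r) r → ζ x = 0 := fun x hx =>
      image_eq_zero_of_notMem_tsupport fun hx' => hx (hr hx')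
    let θ : ℝ → ℝ := fun t => ∫ x in (-δ)..t, ζ x
    have hθd : ∀ t, HasDerivAt θ (ζ t) t := fun t =>
      intervalIntegral.integral_hasDerivAt_right (hζ.continuous.intervalIntegrable _ _)
        hζ.continuous.stronglyMeasurable.stronglyMeasurableAtFilter hζ.continuous.continuousAt
    have hθ' : deriv θ = ζ := funext fun t => (hθd t).deriv
    have hθs : ContDiff ℝ ∞ θ :=
      contDiff_infty_iff_deriv.2 ⟨fun t => (hθd t).differentiableAt, hθ' ▸ hζ⟩
    have hθz : ∀ t, t ∉ Icc (-r) r → θ t = 0 := by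
      intro t ht
      rw [mem_Icc, not_and_or, not_le, not_le] at ht
      rcases ht with ht | ht
      · refine (intervalIntegral.integral_congr (g := fun _ => 0) fun x hx => ?_).trans (by simp)
        refine hz x fun hx' => ?_
        have : x ≤ max (-δ) t := hx.2
        rcases le_max_iff.1 this with h1 | h1 <;> linarith [hx'.1]
      · have h1 : θ t = ∫ x in Ioc (-δ) t, ζ x := by
          refine intervalIntegral.integral_of_le (by linarith)
        rw [h1, setIntegral_eq_integral_of_forall_compl_eq_zero, hζ0]
        intro x hx
        refine hz x fun hx' => hx ⟨by linarith [hx'.1], by linarith [hx'.2]⟩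
    have hθt : tsupport θ ⊆ Icc (-r) r :=
      closure_minimal (fun x hx => by_contra fun hx' => hx (hθz x hx')) isClosed_Icc
    have := h θ hθs (HasCompactSupport.intro isCompact_Icc hθz)
      (hθt.trans fun x hx => ⟨by linarith [hx.1], by linarith [hx.2]⟩)
    rwa [hθ'] at this
  obtain ⟨C, hC⟩ : ∃ C, C = ∫ x, ψ.normed volume x * f x := ⟨_, rfl⟩
  have hae : ∀ᵐ x, x ∈ Ioo (-δ) δ → f x - C = 0 := by
    refine isOpen_Ioo.ae_eq_zero_of_integral_contDiff_smul_eq_zero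
      ((hf.sub continuousOn_const).locallyIntegrableOn measurableSet_Ioo) ?_
    intro g hg hgc hgt
    obtain ⟨c, hc⟩ : ∃ c, c = ∫ x, g x := ⟨_, rfl⟩
    have hgi : Integrable g := hg.continuous.integrable_of_hasCompactSupport hgc
    have hψint : Integrable (ψ.normed volume) :=
      hψs.continuous.integrable_of_hasCompactSupport hψc
    have h1 := hzero (fun x => g x - c * ψ.normed volume x) (hg.sub (contDiff_const.mul hψs))
      (hgc.sub hψc.mul_left)
      ((tsupport_sub _ _).trans (union_subset hgt ((tsupport_mul_subset_right).trans hψt)))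
      (by rw [integral_sub hgi (hψint.const_mul c), integral_const_mul, hψi, hc]; ring)
    have h2 : ∀ x, (g x - c * ψ.normed volume x) * f x =
        g x * f x - c * (ψ.normed volume x * f x) := fun x => by ring
    simp only [h2] at h1
    rw [integral_sub (hint g hg hgc hgt) ((hint _ hψs hψc hψt).const_mul c), integral_const_mul,
      ← hC] at h1
    simp only [smul_eq_mul, mul_sub]
    rw [integral_sub (hint g hg hgc hgt) (hgi.mul_const C), integral_mul_const, ← hc]
    linarith
  have heq : EqOn f (fun _ => C) (Ioo (-δ) δ) := by
    refine Measure.eqOn_open_of_ae_eq (μ := volume) ?_ isOpen_Ioo hf continuousOn_const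
    rw [Filter.EventuallyEq, ae_restrict_iff' measurableSet_Ioo]
    filter_upwards [hae] with x hx hx'
    linarith [hx hx']
  rw [heq ht, heq (show (0 : ℝ) ∈ Ioo (-δ) δ from ⟨by linarith, hδ⟩)]

/-- Integrals of a continuous, compactly supported, time-dependent function against a narrowly
continuous curve of probability measures depend continuously on time. -/
theorem continuousAt_integral_of_hasCompactSupport {E : Type*} [NormedAddCommGroup E]
    [MeasurableSpace E] [BorelSpace E] {u : ℝ × E → ℝ} (hu : Continuous u)
    (hus : HasCompactSupport u) {ν : ℝ → ProbabilityMeasure E} {t : ℝ} (hν : ContinuousAt ν t) :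
    ContinuousAt (fun s => ∫ x, u (s, x) ∂(ν s : Measure E)) t := by
  obtain ⟨M, hM⟩ := hus.exists_bound_of_continuous hu
  have hint : ∀ s r, Integrable (fun x => u (s, x)) (ν r : Measure E) := fun s r =>
    Integrable.of_bound
      (by fun_prop : Continuous fun x => u (s, x)).aestronglyMeasurable M (ae_of_all _ fun x => hM _)
  have h1 : Filter.Tendsto (fun s => ∫ x, u (t, x) ∂(ν s : Measure E)) (𝓝 t)
      (𝓝 (∫ x, u (t, x) ∂(ν t : Measure E))) :=
    ProbabilityMeasure.tendsto_iff_forall_integral_tendsto.1 hν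
      (BoundedContinuousFunction.ofNormedAddCommGroup (fun x => u (t, x)) (by fun_prop) M
        fun x => hM _)
  have h2 : Filter.Tendsto (fun s => ∫ x, u (s, x) ∂(ν s : Measure E) -
      ∫ x, u (t, x) ∂(ν s : Measure E)) (𝓝 t) (𝓝 0) := by
    rw [Metric.tendsto_nhds]
    intro ε hε
    obtain ⟨δ, hδ, H⟩ := Metric.uniformContinuous_iff.1
      (hus.uniformContinuous_of_continuous hu) (ε / 2) (half_pos hε)
    filter_upwards [Metric.ball_mem_nhds t hδ] with s hs
    rw [← integral_sub (hint _ _) (hint _ _), dist_zero_right]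
    have h3 := norm_integral_le_of_norm_le_const (μ := (ν s : Measure E))
      (f := fun x => u (s, x) - u (t, x)) (C := ε / 2) (ae_of_all _ fun x => by
        rw [← dist_eq_norm]
        refine (H ?_).le
        simpa [Prod.dist_eq, hδ] using hs)
    simp only [probReal_univ, mul_one] at h3
    linarith
  have h3 := h2.add h1
  simpa [ContinuousAt] using h3

end TestFunctions

section Transport

/-- The convective derivative is the derivative along the trajectories of the velocity field. -/
theorem hasDerivAt_along_trajectory {d : ℕ} {G : Type*} [NormedAddCommGroup G] [NormedSpace ℝ G]
    {Φ : ℝ → Eucl d → Eucl d} {g : ℝ → Eucl d → G} {t : ℝ} {c : ℝ → Eucl d}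
    (hg : DifferentiableAt ℝ (Function.uncurry g) (t, c t)) (hc : HasDerivAt c (Φ t (c t)) t) :
    HasDerivAt (fun s => g s (c s)) (convDeriv Φ g t (c t)) t := by
  have hd := hg.hasFDerivAt
  have h1 : HasDerivAt (fun s => g s (c s))
      (fderiv ℝ (Function.uncurry g) (t, c t) (1, Φ t (c t))) t :=
    hd.comp_hasDerivAt (f := fun s => (s, c s)) t ((hasDerivAt_id t).prodMk hc)
  have ht : HasDerivAt (fun s => g s (c t)) (fderiv ℝ (Function.uncurry g) (t, c t) (1, 0)) t :=
    hd.comp_hasDerivAt (f := fun s => (s, c t)) t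
      ((hasDerivAt_id t).prodMk (hasDerivAt_const t (c t)))
  have hx : HasFDerivAt (g t) ((fderiv ℝ (Function.uncurry g) (t, c t)).comp
      (ContinuousLinearMap.inr ℝ ℝ (Eucl d))) (c t) :=
    hd.comp (c t) (hasFDerivAt_prodMk_right t (c t))
  convert h1 using 1
  rw [convDeriv, ht.deriv, hx.fderiv]
  simp only [ContinuousLinearMap.comp_apply, ContinuousLinearMap.inr_apply]
  rw [← map_add]
  simp

/-- `X h` is the flow from time `t₀` to time `t₀ + h` of the field `Φ` for `|h| < δ`, extended to
all `h` as a smooth family of diffeomorphisms with inverses `Y h`. -/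
structure IsFlowAt {d : ℕ} (I : Set ℝ) (Φ : ℝ → Eucl d → Eucl d) (t₀ δ : ℝ)
    (X Y : ℝ → Eucl d → Eucl d) : Prop where
  pos : 0 < δ
  mem : ∀ h, |h| < δ → t₀ + h ∈ I
  contDiff : ContDiff ℝ ∞ (Function.uncurry X)
  contDiff_inv : ContDiff ℝ ∞ (Function.uncurry Y)
  zero : ∀ x, X 0 x = x
  left_inv : ∀ h x, Y h (X h x) = x
  right_inv : ∀ h x, X h (Y h x) = x
  lipschitz : ∀ h, LipschitzWith 2 (X h)
  hasDerivAt : ∀ h, |h| < δ → ∀ x, HasDerivAt (fun s => X s x) (Φ (t₀ + h) (X h x)) h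

theorem IsRegularTransportCouple.exists_isFlowAt {d : ℕ} {I : Set ℝ} (hI : IsOpen I)
    {μ : ℝ → P2 d} {Φ : ℝ → Eucl d → Eucl d} (hμ : IsRegularTransportCouple I μ Φ)
    {t₀ : ℝ} (ht₀ : t₀ ∈ I) : ∃ δ X Y, IsFlowAt I Φ t₀ δ X Y := by
  obtain ⟨ε, hε, hball⟩ := Metric.nhds_basis_closedBall.mem_iff.1 (hI.mem_nhds ht₀)
  obtain ⟨L, hL⟩ := hμ.lipschitz 0 _ hball (isCompact_closedBall t₀ ε)
  obtain ⟨ρ, hρ, hρε, hρid⟩ := exists_contDiff_truncation hε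
  have hmem : ∀ h, t₀ + ρ h ∈ Metric.closedBall t₀ ε := fun h => by
    simpa [Real.dist_eq] using hρε h
  have hV : ContDiff ℝ ∞ fun z : ℝ × Eucl d => Φ (t₀ + ρ z.1) z.2 := by
    rw [← contDiffOn_univ]
    exact hμ.contDiffOn.comp (f := fun z : ℝ × Eucl d => (t₀ + ρ z.1, z.2))
      (ContDiff.contDiffOn (by fun_prop)) fun z _ => ⟨hball (hmem z.1), mem_univ _⟩
  have hVL : ∀ t, LipschitzWith L fun x => (fun z : ℝ × Eucl d => Φ (t₀ + ρ z.1) z.2) (t, x) :=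
    fun t => hL (t₀ + ρ t) (hmem t)
  obtain ⟨δ, hδ, X, Y, hX, hY, h0, hl, hr, hlip, hd⟩ := exists_contDiff_flow hV hVL
  have hle : ∀ h, |h| < min δ (ε / 2) → ρ h = h := fun h hh =>
    hρid h (hh.le.trans (min_le_right _ _))
  refine ⟨min δ (ε / 2), X, Y, lt_min hδ (half_pos hε), fun h hh => ?_, hX, hY, h0, hl, hr, hlip,
    fun h hh x => ?_⟩
  · rw [← hle h hh]
    exact hball (hmem h)
  · have := hd h (hh.trans_le (min_le_left _ _)) x
    simpa only [hle h hh] using this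

namespace IsFlowAt

variable {d : ℕ} {I : Set ℝ} {Φ : ℝ → Eucl d → Eucl d} {t₀ δ : ℝ} {X Y : ℝ → Eucl d → Eucl d}

theorem hasDerivAt_comp (hX : IsFlowAt I Φ t₀ δ X Y) (hI : IsOpen I) {G : Type*}
    [NormedAddCommGroup G] [NormedSpace ℝ G] {g : ℝ → Eucl d → G}
    (hg : ContDiffOn ℝ ∞ (Function.uncurry g) (I ×ˢ (univ : Set (Eucl d)))) {h : ℝ} (hh : |h| < δ)
    (x : Eucl d) :
    HasDerivAt (fun s => g (t₀ + s) (X s x)) (convDeriv Φ g (t₀ + h) (X h x)) h := by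
  have hg' : DifferentiableAt ℝ (Function.uncurry g) (t₀ + h, X h x) :=
    (hg.contDiffAt ((hI.prod isOpen_univ).mem_nhds ⟨hX.mem h hh, mem_univ _⟩)).differentiableAt
      (by simp)
  have h1 : HasDerivAt (fun s => X (s - t₀) x) (Φ (t₀ + h) (X h x)) (t₀ + h) := by
    have := hX.hasDerivAt h hh x
    rw [show h = t₀ + h - t₀ by ring] at this
    simpa using this.comp_sub_const (t₀ + h) t₀
  have h2 := hasDerivAt_along_trajectory (c := fun s => X (s - t₀) x) (g := g) (t := t₀ + h)
    (by simpa using hg') (by simpa using h1)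
  have h3 := h2.comp_const_add t₀ h
  simpa using h3

/-- The derivatives in time of the flow are the iterated convective derivatives of the velocity
field. -/
theorem iteratedDeriv_succ (hX : IsFlowAt I Φ t₀ δ X Y) (hI : IsOpen I)
    (hΦ : ContDiffOn ℝ ∞ (Function.uncurry Φ) (I ×ˢ (univ : Set (Eucl d)))) (x : Eucl d) (j : ℕ) :
    ∀ h, |h| < δ → iteratedDeriv (j + 1) (fun s => X s x) h = iterConv Φ j (t₀ + h) (X h x) := by
  induction j with
  | zero =>
    intro h hh
    rw [zero_add, iteratedDeriv_one]
    exact (hX.hasDerivAt h hh x).deriv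
  | succ j ih =>
    intro h hh
    rw [_root_.iteratedDeriv_succ]
    have h1 : iteratedDeriv (j + 1) (fun s => X s x) =ᶠ[𝓝 h]
        fun s => iterConv Φ j (t₀ + s) (X s x) := by
      filter_upwards [(isOpen_lt continuous_abs continuous_const).mem_nhds hh] with s hs
      exact ih s hs
    rw [h1.deriv_eq]
    exact (hX.hasDerivAt_comp hI (iterConv_contDiffOn hI hΦ j) hh x).deriv

theorem hasCompactSupport (hX : IsFlowAt I Φ t₀ δ X Y) {θ : ℝ → ℝ} {f : Eucl d → ℝ}
    (hθ : HasCompactSupport θ) (hf : HasCompactSupport f) :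
    HasCompactSupport (fun z : ℝ × Eucl d => θ z.1 * f (Y z.1 z.2)) ∧
      tsupport (fun z : ℝ × Eucl d => θ z.1 * f (Y z.1 z.2)) ⊆
        tsupport θ ×ˢ (univ : Set (Eucl d)) := by
  have hK : IsCompact ((fun z : ℝ × Eucl d => (z.1, X z.1 z.2)) '' (tsupport θ ×ˢ tsupport f)) :=
    (hθ.isCompact.prod hf.isCompact).image (continuous_fst.prodMk hX.contDiff.continuous)
  have hz : ∀ z, z ∉ (fun z : ℝ × Eucl d => (z.1, X z.1 z.2)) '' (tsupport θ ×ˢ tsupport f) →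
      θ z.1 * f (Y z.1 z.2) = 0 := by
    intro z hz
    by_contra hne
    refine hz ⟨(z.1, Y z.1 z.2), ⟨subset_tsupport _ (left_ne_zero_of_mul hne),
      subset_tsupport _ (right_ne_zero_of_mul hne)⟩, ?_⟩
    simp only [hX.right_inv]
  refine ⟨HasCompactSupport.intro hK hz, ?_⟩
  refine (closure_minimal (fun z hz' => by_contra fun h =>
    Function.mem_support.1 hz' (hz z h)) hK.isClosed).trans ?_
  rintro _ ⟨z, hz, rfl⟩
  exact ⟨hz.1, mem_univ _⟩

/-- The curve of measures of a transport couple is transported by the flow of its velocity field. -/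
theorem map_eq (hX : IsFlowAt I Φ t₀ δ X Y) (hI : IsOpen I) {μ : ℝ → P2 d}
    (hμ : IsTransportCouple I μ Φ) {h : ℝ} (hh : |h| < δ) :
    (μ (t₀ + h)).meas = (μ t₀).meas.map (X h) := by
  have hXc : ∀ h, Continuous (X h) := fun h => (hX.lipschitz h).continuous
  have hYs : ∀ h, ContDiff ℝ ∞ (Y h) := fun h =>
    hX.contDiff_inv.comp (contDiff_const.prodMk contDiff_id)
  have hYc : ∀ h, Continuous (Y h) := fun h => (hYs h).continuous
  have hY0 : ∀ x, Y 0 x = x := fun x => by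
    have := hX.right_inv 0 x
    rwa [hX.zero] at this
  have key : ∀ f : Eucl d → ℝ, ContDiff ℝ ∞ f → HasCompactSupport f → ∀ h ∈ Ioo (-δ) δ,
      ∫ x, f (Y h x) ∂(μ (t₀ + h)).meas = ∫ x, f (Y 0 x) ∂(μ (t₀ + 0)).meas := by
    intro f hf hfs h hh
    refine eq_of_forall_integral_deriv_mul_eq_zero hX.pos
      (f := fun h => ∫ x, f (Y h x) ∂(μ (t₀ + h)).meas) ?_ ?_ hh
    · intro s hs
      refine ContinuousAt.continuousWithinAt ?_
      have hs' := abs_lt.2 hs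
      let ψ : ContDiffBump s := ⟨1, 2, one_pos, one_lt_two⟩
      have hc : Continuous fun z : ℝ × Eucl d => ψ z.1 * f (Y z.1 z.2) :=
        (ψ.continuous.comp continuous_fst).mul (hf.continuous.comp hX.contDiff_inv.continuous)
      have hcs := (hX.hasCompactSupport ψ.hasCompactSupport hfs).1
      have hμc : ContinuousAt (fun r => (μ (t₀ + r)).1) s := by
        refine continuous_subtype_val.continuousAt.comp ?_
        exact ContinuousAt.comp (g := μ)
          (hμ.continuousOn.continuousAt (hI.mem_nhds (hX.mem s hs'))) (by fun_prop)
      refine (continuousAt_integral_of_hasCompactSupport hc hcs hμc).congr ?_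
      filter_upwards [Metric.closedBall_mem_nhds s one_pos] with r hr
      simp [ψ.one_of_mem_closedBall hr]
    · intro θ hθ hθs hθt
      have hs := hX.hasCompactSupport hθs hfs
      let τ : ℝ × Eucl d → ℝ × Eucl d := fun z => (z.1 - t₀, z.2)
      have hτ : Continuous τ := by fun_prop
      let η : ℝ → Eucl d → ℝ := fun t x => θ (t - t₀) * f (Y (t - t₀) x)
      have hη : Function.uncurry η =
          (fun z : ℝ × Eucl d => θ z.1 * f (Y z.1 z.2)) ∘ (Homeomorph.subRight (t₀, 0)) := by
        funext z
        simp [η, Function.uncurry]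
      have hηs : ContDiff ℝ ∞ (Function.uncurry η) := by
        have h1 : ContDiff ℝ ∞ fun z : ℝ × Eucl d => Y (z.1 - t₀) z.2 :=
          hX.contDiff_inv.comp ((contDiff_fst.sub contDiff_const).prodMk contDiff_snd)
        exact ((hθ.comp (contDiff_fst.sub contDiff_const))).mul (hf.comp h1)
      have hηt : tsupport (Function.uncurry η) ⊆ 
          ((fun t => t - t₀) ⁻¹' Ioo (-δ) δ) ×ˢ (univ : Set (Eucl d)) := by
        rw [hη, tsupport_comp_eq_preimage]
        intro z hz
        exact ⟨hθt (by simpa using (hs.2 hz).1), mem_univ _⟩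
      have hIoo : ∀ t, t - t₀ ∈ Ioo (-δ) δ → t ∈ I := fun t ht => by
        simpa using hX.mem _ (abs_lt.2 ht)
      have hce := hμ.continuity_eq η hηs
        (hη ▸ hs.1.comp_homeomorph (Homeomorph.subRight (t₀, 0)))
        (hηt.trans (prod_mono hIoo subset_rfl))
      have hpt : ∀ t x, deriv (fun s => η s x) t + fderiv ℝ (η t) x (Φ t x) =
          deriv θ (t - t₀) * f (Y (t - t₀) x) := by
        intro t x
        by_cases ht : t - t₀ ∈ Ioo (-δ) δ
        · have hd := hX.hasDerivAt (t - t₀) (abs_lt.2 ht) (Y (t - t₀) x)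
          rw [hX.right_inv, add_sub_cancel] at hd
          have hd' : HasDerivAt (fun s => X (s - t₀) (Y (t - t₀) x)) (Φ t x) t :=
            hd.comp_sub_const t t₀
          have h1 := hasDerivAt_along_trajectory (Φ := Φ) (g := η) (t := t)
            (c := fun s => X (s - t₀) (Y (t - t₀) x))
            (hηs.differentiable (by simp)).differentiableAt (by simpa [hX.right_inv] using hd')
          have h2 : HasDerivAt (fun s => η s (X (s - t₀) (Y (t - t₀) x)))
              (deriv θ (t - t₀) * f (Y (t - t₀) x)) t := by
            simp only [η, hX.left_inv]
            exact HasDerivAt.mul_const (HasDerivAt.comp_sub_const t t₀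
              (hθ.differentiable (by simp)).differentiableAt.hasDerivAt) _
          have h3 := h1.unique h2
          simp only [hX.right_inv] at h3
          exact h3
        · have hn : t - t₀ ∉ tsupport θ := fun h => ht (hθt h)
          have h0 : θ =ᶠ[𝓝 (t - t₀)] fun _ => 0 := by
            filter_upwards [(isClosed_tsupport θ).isOpen_compl.mem_nhds hn] with s hs
            exact image_eq_zero_of_notMem_tsupport hs
          have h1 : (fun s => η s x) =ᶠ[𝓝 t] fun _ => 0 := by
            have : Filter.Tendsto (fun s : ℝ => s - t₀) (𝓝 t) (𝓝 (t - t₀)) :=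
              (continuous_id.sub continuous_const).continuousAt
            filter_upwards [this.eventually h0] with s hs
            simp [η, hs]
          have h2 : η t = fun _ => 0 := by
            funext y
            simp [η, h0.self_of_nhds]
          rw [h1.deriv_eq, h2, h0.deriv_eq]
          simp
      simp only [hpt, integral_const_mul] at hce
      rw [setIntegral_eq_integral_of_forall_compl_eq_zero] at hce
      · rw [← hce, ← integral_sub_right_eq_self (fun t => deriv θ t *
          ∫ x, f (Y t x) ∂(μ (t₀ + t)).meas) t₀]
        simp
      · intro t ht
        have : t - t₀ ∉ tsupport θ := fun h => ht (hIoo t (hθt h))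
        have h0 : deriv θ (t - t₀) = 0 :=
          image_eq_zero_of_notMem_tsupport fun h => this (tsupport_deriv_subset h)
        rw [h0, zero_mul]
  have hmap : (μ (t₀ + h)).meas.map (Y h) = (μ t₀).meas := by
    have : IsProbabilityMeasure ((μ (t₀ + h)).meas.map (Y h)) :=
      Measure.isProbabilityMeasure_map (hYc h).aemeasurable
    refine Measure.ext_of_integral_contDiff fun f hf hfs => ?_
    rw [integral_map (hYc h).aemeasurable hf.continuous.aestronglyMeasurable,
      key f hf hfs h (abs_lt.1 hh)]
    simp [hY0]
  rw [← hmap, Measure.map_map (hXc h).measurable (hYc h).measurable]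
  have : X h ∘ Y h = id := funext (hX.right_inv h)
  rw [this, Measure.map_id]

end IsFlowAt

end Transport

section Geodesics

variable {d : ℕ}

theorem P2.ext {μ ν : P2 d} (h : μ.meas = ν.meas) : μ = ν :=
  Subtype.ext (Subtype.ext h)

theorem P2.memLp_of_lipschitz (μ : P2 d) {T : Eucl d → Eucl d} {L : ℝ≥0}
    (hT : LipschitzWith L T) : MemLp T 2 μ.meas := by
  have h1 : MemLp (fun x : Eucl d => ‖T 0‖ + (L : ℝ) * ‖x‖) 2 μ.meas :=
    (memLp_const (μ := μ.meas) (p := 2) ‖T 0‖).add (μ.2.norm.const_mul (L : ℝ))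
  refine h1.mono' hT.continuous.aestronglyMeasurable (ae_of_all _ fun x => ?_)
  have h2 := hT.norm_sub_le x 0
  have h3 := norm_add_le (T 0) (T x - T 0)
  rw [add_sub_cancel] at h3
  rw [sub_zero] at h2
  linarith

theorem LipField.exists_lipschitzWith_id_add (Ψ : LipField d) :
    ∃ L : ℝ≥0, LipschitzWith L fun x => x + (Ψ : Eucl d → Eucl d) x := by
  obtain ⟨L, hL⟩ := Ψ.2.2
  exact ⟨1 + L, LipschitzWith.id.add hL⟩

/-- The push-forward of `μ` under `id + Ψ`. -/
noncomputable def P2.displace (μ : P2 d) (Ψ : LipField d) : P2 d :=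
  ⟨⟨μ.meas.map fun x => x + (Ψ : Eucl d → Eucl d) x,
    Measure.isProbabilityMeasure_map
      (continuous_id.add Ψ.2.1.continuous).aemeasurable⟩, by
    obtain ⟨L, hL⟩ := LipField.exists_lipschitzWith_id_add Ψ
    refine (memLp_map_measure_iff (by fun_prop) hL.continuous.aemeasurable).2 ?_
    exact μ.memLp_of_lipschitz hL⟩

theorem P2.displace_meas (μ : P2 d) (Ψ : LipField d) :
    (μ.displace Ψ).meas = μ.meas.map fun x => x + (Ψ : Eucl d → Eucl d) x := rfl

theorem P2.displace_zero (μ : P2 d) : μ.displace 0 = μ := by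
  refine P2.ext ?_
  rw [P2.displace_meas]
  simp

/-- The trajectories of a convective geodesic are straight lines. -/
theorem IsConvectiveGeodesic.flow_eq {J : Set ℝ} (hJ : IsOpen J) {ν : ℝ → P2 d}
    {Ψ : ℝ → Eucl d → Eucl d} (hν : IsConvectiveGeodesic J ν Ψ) {t₀ δ : ℝ}
    {X Y : ℝ → Eucl d → Eucl d} (hX : IsFlowAt J Ψ t₀ δ X Y) {h : ℝ} (hh : |h| < δ)
    (x : Eucl d) : X h x = x + h • Ψ t₀ x := by
  have h0 : (0 : ℝ) ∈ Ioo (-δ) δ := ⟨by linarith [hX.pos], hX.pos⟩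
  have hd : ∀ s ∈ Ioo (-δ) δ, HasDerivAt (fun s => Ψ (t₀ + s) (X s x)) 0 s := fun s hs => by
    have h1 := hX.hasDerivAt_comp hJ hν.contDiffOn (abs_lt.2 hs) x
    rwa [hν.convDeriv_eq_zero _ (hX.mem s (abs_lt.2 hs))] at h1
  have hconst : ∀ s ∈ Ioo (-δ) δ, Ψ (t₀ + s) (X s x) = Ψ t₀ x := by
    intro s hs
    have := isOpen_Ioo.eqOn_of_deriv_eq (𝕜 := ℝ) isPreconnected_Ioo
      (f := fun s => Ψ (t₀ + s) (X s x)) (g := fun _ => Ψ t₀ x)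
      (fun s hs => (hd s hs).differentiableAt.differentiableWithinAt)
      (differentiableOn_const _) (fun s hs => by simp [(hd s hs).deriv]) h0
      (by simp [hX.zero]) hs
    exact this
  have hd2 : ∀ s ∈ Ioo (-δ) δ, HasDerivAt (fun s => X s x) (Ψ t₀ x) s := fun s hs => by
    have := hX.hasDerivAt s (abs_lt.2 hs) x
    rwa [hconst s hs] at this
  have hd3 : ∀ s : ℝ, HasDerivAt (fun s : ℝ => x + s • Ψ t₀ x) (Ψ t₀ x) s := fun s => by
    simpa using ((hasDerivAt_id s).smul_const (Ψ t₀ x)).const_add x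
  exact isOpen_Ioo.eqOn_of_deriv_eq (𝕜 := ℝ) isPreconnected_Ioo
    (f := fun s => X s x) (g := fun s => x + s • Ψ t₀ x)
    (fun s hs => (hd2 s hs).differentiableAt.differentiableWithinAt)
    (fun s _ => (hd3 s).differentiableAt.differentiableWithinAt)
    (fun s hs => by rw [(hd2 s hs).deriv, (hd3 s).deriv]) h0
    (by simp [hX.zero]) (abs_lt.1 hh)

/-- Along a convective geodesic the measure is displaced along the initial velocity. -/
theorem IsConvectiveGeodesic.eventually_eq_displace {J : Set ℝ} (hJ : IsOpen J) {ν : ℝ → P2 d}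
    {Ψ : ℝ → Eucl d → Eucl d} (hν : IsConvectiveGeodesic J ν Ψ) {t : ℝ} (ht : t ∈ J) :
    ∀ᶠ h in 𝓝 (0 : ℝ), ν (t + h) =
      (ν t).displace (h • iterConvField hJ hν.toIsRegularTransportCouple ht 0) := by
  obtain ⟨δ, X, Y, hX⟩ := hν.toIsRegularTransportCouple.exists_isFlowAt hJ ht
  have : ∀ᶠ h in 𝓝 (0 : ℝ), |h| < δ :=
    (isOpen_lt continuous_abs continuous_const).mem_nhds (by simpa using hX.pos)
  filter_upwards [this] with h hh
  refine P2.ext ?_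
  rw [hX.map_eq hJ hν.toIsTransportCouple hh, P2.displace_meas]
  congr 1
  funext x
  exact hν.flow_eq hJ hX hh x

theorem iterConv_succ_eq_zero {J : Set ℝ} (hJ : IsOpen J) {Ψ : ℝ → Eucl d → Eucl d}
    (h : ∀ t ∈ J, ∀ x, convDeriv Ψ Ψ t x = 0) (j : ℕ) :
    ∀ t ∈ J, iterConv Ψ (j + 1) t = 0 := by
  induction j with
  | zero => exact fun t ht => funext fun x => h t ht x
  | succ j ih =>
    intro t ht
    funext x
    change deriv (fun s => iterConv Ψ (j + 1) s x) t +
      fderiv ℝ (iterConv Ψ (j + 1) t) x (Ψ t x) = 0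
    have h1 : (fun s => iterConv Ψ (j + 1) s x) =ᶠ[𝓝 t] fun _ => 0 := by
      filter_upwards [hJ.mem_nhds ht] with s hs
      rw [ih s hs]
      rfl
    rw [h1.deriv_eq, ih t ht]
    simp

theorem P2.continuous_displace_smul (μ : P2 d) (Ψ : LipField d) :
    Continuous fun s : ℝ => μ.displace (s • Ψ) := by
  refine Continuous.subtype_mk (continuous_iff_continuousAt.2 fun t => ?_) _
  refine ProbabilityMeasure.tendsto_iff_forall_integral_tendsto.2 fun f => ?_
  have hΨ : Continuous (Ψ : Eucl d → Eucl d) := Ψ.2.1.continuous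
  have h1 : ∀ s : ℝ, ∫ x, f x ∂(μ.displace (s • Ψ)).meas =
      ∫ x, f (x + s • (Ψ : Eucl d → Eucl d) x) ∂μ.meas := fun s => by
    rw [P2.displace_meas]
    exact integral_map (continuous_id.add (s • Ψ).2.1.continuous).aemeasurable
      f.continuous.aestronglyMeasurable
  change Filter.Tendsto (fun s : ℝ => ∫ x, f x ∂(μ.displace (s • Ψ)).meas) (𝓝 t)
    (𝓝 (∫ x, f x ∂(μ.displace (t • Ψ)).meas))
  simp only [h1]
  refine (continuous_of_dominated (F := fun (s : ℝ) x => f (x + s • (Ψ : Eucl d → Eucl d) x))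
    (bound := fun _ => ‖f‖) (fun s => ?_) (fun s => ae_of_all _ fun x => f.norm_coe_le_norm _)
    (integrable_const _) (ae_of_all _ fun x => by fun_prop)).tendsto t
  exact (f.continuous.comp (by fun_prop :
    Continuous fun x => x + s • (Ψ : Eucl d → Eucl d) x)).aestronglyMeasurable

/-- Weak continuity equation for measures moving along straight lines. -/
theorem P2.integral_deriv_along_displacement (μ : P2 d) (Ψ : LipField d) (t ε : ℝ)
    {η : ℝ × Eucl d → ℝ} (hη : ContDiff ℝ ∞ η) (hηc : HasCompactSupport η)
    (hηt : tsupport η ⊆ Ioo (t - ε) (t + ε) ×ˢ (univ : Set (Eucl d))) :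
    ∫ s in Ioo (t - ε) (t + ε), ∫ x, fderiv ℝ η (s, x + (s - t) • (Ψ : Eucl d → Eucl d) x)
      (1, (Ψ : Eucl d → Eucl d) x) ∂μ.meas = 0 := by
  obtain ⟨ψ, hψ⟩ : ∃ ψ, ψ = (Ψ : Eucl d → Eucl d) := ⟨_, rfl⟩
  have hψc : Continuous ψ := hψ ▸ Ψ.2.1.continuous
  have hψi : Integrable (fun x => ‖ψ x‖) μ.meas :=
    hψ ▸ ((LipField.memLp μ Ψ).integrable one_le_two).norm
  rw [← hψ]
  have hη' : Continuous (fderiv ℝ η) := hη.continuous_fderiv (by simp)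
  obtain ⟨M, hM⟩ := (hηc.fderiv ℝ).exists_bound_of_continuous hη'
  have hM0 : 0 ≤ M := (norm_nonneg _).trans (hM 0)
  let D : ℝ → Eucl d → ℝ := fun s x => fderiv ℝ η (s, x + (s - t) • ψ x) (1, ψ x)
  have hD : Continuous (Function.uncurry D) :=
    (hη'.comp (by fun_prop : Continuous fun z : ℝ × Eucl d => (z.1, z.2 + (z.1 - t) • ψ z.2))
      ).clm_apply (by fun_prop)
  have hDb : ∀ z, ‖Function.uncurry D z‖ ≤ M * (1 + ‖ψ z.2‖) := by
    intro z
    refine ((fderiv ℝ η _).le_of_opNorm_le (hM _) _).trans ?_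
    gcongr
    rw [Prod.norm_def]
    refine max_le ?_ ?_
    · simp
    · simp
  have hswap := integral_integral_swap (μ := volume.restrict (Ioo (t - ε) (t + ε))) (ν := μ.meas)
    (f := D) (by
      refine Integrable.mono' (g := fun z => M * (1 + ‖ψ z.2‖)) ?_ hD.aestronglyMeasurable
        (ae_of_all _ hDb)
      exact (((integrable_const (1 : ℝ)).add hψi).const_mul M).comp_snd _)
  change ∫ s in Ioo (t - ε) (t + ε), ∫ x, D s x ∂μ.meas = 0
  rw [hswap]
  refine integral_eq_zero_of_ae (ae_of_all _ fun x => ?_)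
  have hmem : ∀ z, z ∈ tsupport η → z.1 ∈ Prod.fst '' tsupport η := fun z hz => ⟨z, hz, rfl⟩
  have hK : IsCompact (Prod.fst '' tsupport η) := hηc.isCompact.image continuous_fst
  have hKI : Prod.fst '' tsupport η ⊆ Ioo (t - ε) (t + ε) := by
    rintro _ ⟨z, hz, rfl⟩
    exact (hηt hz).1
  have hD0 : ∀ s, s ∉ Prod.fst '' tsupport η → D s x = 0 := by
    intro s hs
    have : fderiv ℝ η (s, x + (s - t) • ψ x) = 0 := image_eq_zero_of_notMem_tsupport fun h =>
      hs (hmem _ (tsupport_fderiv_subset ℝ h))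
    simp [D, this]
  have hDx : Continuous fun s => D s x := hD.comp (by fun_prop : Continuous fun s : ℝ => (s, x))
  have hw : Continuous fun s : ℝ => η (s, x + (s - t) • ψ x) :=
    hη.continuous.comp (by fun_prop)
  change ∫ s in Ioo (t - ε) (t + ε), D s x = 0
  rw [setIntegral_eq_integral_of_forall_compl_eq_zero fun s hs => hD0 s fun h => hs (hKI h)]
  refine integral_eq_zero_of_hasDerivAt_of_integrable
    (f := fun s : ℝ => η (s, x + (s - t) • ψ x)) (fun s => ?_)
    (hDx.integrable_of_hasCompactSupport (HasCompactSupport.intro hK hD0))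
    (hw.integrable_of_hasCompactSupport (HasCompactSupport.intro hK fun s hs =>
      image_eq_zero_of_notMem_tsupport fun h => hs (hmem _ h)))
  have h1 : HasDerivAt (fun s : ℝ => (s, x + (s - t) • ψ x)) (1, ψ x) s := by
    refine (hasDerivAt_id s).prodMk ?_
    simpa using (((hasDerivAt_id s).sub_const t).smul_const (ψ x)).const_add x
  exact (hη.differentiable (by simp)).differentiableAt.hasFDerivAt.comp_hasDerivAt s h1

/-- Through every measure, in the direction of every smooth Lipschitz field, passes a convective
geodesic. -/
theorem exists_isConvectiveGeodesic (μ : P2 d) (Ψ : LipField d) (t : ℝ) :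
    ∃ (J : Set ℝ) (_ : IsOpen J) (_ : J.OrdConnected) (_ : t ∈ J) (ν : ℝ → P2 d)
      (Φ : ℝ → Eucl d → Eucl d), IsConvectiveGeodesic J ν Φ ∧ ν t = μ ∧
        Φ t = (Ψ : Eucl d → Eucl d) := by
  obtain ⟨L, hL⟩ := Ψ.2.2
  obtain ⟨ψ, hψ⟩ : ∃ ψ, ψ = (Ψ : Eucl d → Eucl d) := ⟨_, rfl⟩
  have hψs : ContDiff ℝ ∞ ψ := hψ ▸ Ψ.2.1
  rw [← hψ] at hL
  obtain ⟨ε, hε, hεL⟩ : ∃ ε : ℝ, 0 < ε ∧ ε * L ≤ 1 / 2 := by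
    refine ⟨1 / (2 * (L + 1)), by positivity, ?_⟩
    rw [div_mul_eq_mul_div, div_le_div_iff₀ (by positivity) (by norm_num)]
    nlinarith [L.2]
  obtain ⟨ρ, hρ, hρε, hρid⟩ := exists_contDiff_truncation hε
  have hκ : ∀ h, LipschitzWith (1 / 2) fun x => ρ h • ψ x := by
    intro h
    refine LipschitzWith.of_dist_le_mul fun x y => ?_
    rw [dist_eq_norm, dist_eq_norm, ← smul_sub, norm_smul]
    have h1 := hL.norm_sub_le x y
    have h2 : ‖ρ h‖ * ‖ψ x - ψ y‖ ≤ ε * (L * ‖x - y‖) := by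
      gcongr
      exact hρε h
    refine h2.trans ?_
    rw [← mul_assoc]
    push_cast
    gcongr
  obtain ⟨Y, hY, hXY, hYX⟩ := exists_contDiff_inverse (P := ℝ) (X := Eucl d)
    (f := fun z => ρ z.1 • ψ z.2) (by fun_prop) (κ := 1 / 2)
    (by rw [div_lt_one (by norm_num)]; norm_num) hκ
  have hYL : ∀ h, LipschitzWith 2 fun x => Y (h, x) := by
    intro h
    refine LipschitzWith.of_dist_le_mul fun x y => ?_
    have h1 := (hκ h).dist_le_mul (Y (h, x)) (Y (h, y))
    rw [dist_eq_norm, dist_eq_norm] at h1 ⊢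
    have h2 : Y (h, x) - Y (h, y) =
        (x - y) - (ρ h • ψ (Y (h, x)) - ρ h • ψ (Y (h, y))) := by
      have e := congrArg₂ (· - ·) (hXY h x) (hXY h y)
      simp only at e
      rw [← e]
      abel
    have h3 := norm_sub_le (x - y) (ρ h • ψ (Y (h, x)) - ρ h • ψ (Y (h, y)))
    rw [← h2] at h3
    push_cast at h1 ⊢
    linarith
  let J : Set ℝ := Ioo (t - ε / 2) (t + ε / 2)
  have hJρ : ∀ s ∈ J, ρ (s - t) = s - t := fun s hs =>
    hρid _ (abs_le.2 ⟨by linarith [hs.1], by linarith [hs.2]⟩)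
  let Φ : ℝ → Eucl d → Eucl d := fun s x => ψ (Y (s - t, x))
  let ν : ℝ → P2 d := fun s => μ.displace ((s - t) • Ψ)
  have hmap : ∀ s, (ν s).meas = μ.meas.map fun x => x + (s - t) • ψ x := fun s => by
    rw [P2.displace_meas, hψ]
    rfl
  have hmeas : ∀ s : ℝ, Measurable fun x => x + (s - t) • ψ x := fun s =>
    (by fun_prop : Continuous fun x => x + (s - t) • ψ x).measurable
  have hΦX : ∀ s ∈ J, ∀ x, Φ s (x + (s - t) • ψ x) = ψ x := fun s hs x => by
    have := hYX (s - t) x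
    simp only [hJρ s hs] at this
    simp only [Φ, this]
  have hsurj : ∀ s ∈ J, ∀ x, ∃ y, y + (s - t) • ψ y = x := fun s hs x => by
    have := hXY (s - t) x
    simp only [hJρ s hs] at this
    exact ⟨_, this⟩
  have hΦs : ContDiff ℝ ∞ (Function.uncurry Φ) :=
    hψs.comp (hY.comp ((contDiff_fst.sub contDiff_const).prodMk contDiff_snd))
  have hΦc : ∀ s, ContDiff ℝ ∞ (Φ s) := fun s => hΦs.comp (contDiff_const.prodMk contDiff_id)
  have hline : ∀ s x, HasDerivAt (fun s => x + (s - t) • ψ x) (ψ x) s := fun s x => by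
    simpa using (((hasDerivAt_id s).sub_const t).smul_const (ψ x)).const_add x
  have hzero : ∀ s ∈ J, ∀ x, convDeriv Φ Φ s x = 0 := by
    intro s hs x
    obtain ⟨y, rfl⟩ := hsurj s hs x
    have h1 := hasDerivAt_along_trajectory (Φ := Φ) (g := Φ) (t := s)
      (c := fun s => y + (s - t) • ψ y) (hΦs.differentiable (by simp)).differentiableAt
      (by rw [hΦX s hs]; exact hline s y)
    refine h1.unique ((hasDerivAt_const s (ψ y)).congr_of_eventuallyEq ?_)
    filter_upwards [isOpen_Ioo.mem_nhds hs] with r hr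
    exact hΦX r hr y
  have htJ : t ∈ J := ⟨by linarith, by linarith⟩
  refine ⟨J, isOpen_Ioo, ordConnected_Ioo, htJ, ν, Φ, ?_, ?_, ?_⟩
  · refine ⟨⟨⟨?_, fun s _ => hΦc s, fun s hs => ?_, fun K hK hKc => ?_, fun η hη hηc hηt => ?_⟩,
      hΦs.contDiffOn, fun j K hK hKc => ?_⟩, hzero⟩
    · exact ((μ.continuous_displace_smul Ψ).comp
        (by fun_prop : Continuous fun s : ℝ => s - t)).continuousOn
    · rw [hmap, memLp_map_measure_iff (hΦc s).continuous.aestronglyMeasurable (hmeas s).aemeasurable]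
      have : Φ s ∘ (fun x => x + (s - t) • ψ x) = ψ := funext (hΦX s hs)
      rw [this, hψ]
      exact LipField.memLp μ Ψ
    · have h1 : ∀ s ∈ K, ∫⁻ x, ‖Φ s x‖ₑ ^ 2 ∂(ν s).meas = ∫⁻ x, ‖ψ x‖ₑ ^ 2 ∂μ.meas := by
        intro s hs
        rw [hmap, lintegral_map
          ((hΦc s).continuous.enorm.measurable.pow_const 2) (hmeas s)]
        simp only [hΦX s (hK hs)]
      rw [setLIntegral_congr_fun hKc.measurableSet h1, setLIntegral_const]
      refine ENNReal.mul_lt_top ?_ hKc.measure_lt_top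
      have h2 := ((memLp_two_iff_integrable_sq_norm hψs.continuous.aestronglyMeasurable).1
        (hψ ▸ LipField.memLp μ Ψ)).hasFiniteIntegral
      simpa [HasFiniteIntegral, enorm_pow] using h2
    · rw [← μ.integral_deriv_along_displacement Ψ t (ε / 2) hη hηc hηt, ← hψ]
      refine setIntegral_congr_fun measurableSet_Ioo fun s hs => ?_
      have h1 : ∀ x, deriv (fun r => η r x) s + fderiv ℝ (η s) x (Φ s x) =
          fderiv ℝ (Function.uncurry η) (s, x) (1, Φ s x) := by
        intro x
        have hd : HasFDerivAt (Function.uncurry η) (fderiv ℝ (Function.uncurry η) (s, x)) (s, x) :=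
          (hη.differentiable (by simp)).differentiableAt.hasFDerivAt
        have h1 := hasDerivAt_along_trajectory (Φ := fun _ _ => Φ s x) (g := η) (t := s)
          (c := fun r => x + (r - s) • Φ s x) (hη.differentiable (by simp)).differentiableAt
          (by simpa using (((hasDerivAt_id s).sub_const s).smul_const (Φ s x)).const_add x)
        have h2 := hd.comp_hasDerivAt_of_eq (f := fun r => (r, x + (r - s) • Φ s x)) s
          ((hasDerivAt_id s).prodMk (by
            simpa using (((hasDerivAt_id s).sub_const s).smul_const (Φ s x)).const_add x))
          (by simp)
        have h3 := h1.unique h2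
        simpa [convDeriv] using h3
      simp only [h1]
      have hc : Continuous fun x => fderiv ℝ (Function.uncurry η) (s, x) (1, Φ s x) :=
        ((hη.continuous_fderiv (by simp)).comp (by fun_prop)).clm_apply
          (continuous_const.prodMk (hΦc s).continuous)
      rw [hmap, integral_map (hmeas s).aemeasurable hc.aestronglyMeasurable]
      simp only [hΦX s hs]
    · rcases j with - | j
      · exact ⟨L * 2, fun s _ => hL.comp (hYL (s - t))⟩
      · refine ⟨0, fun s hs => ?_⟩
        rw [iterConv_succ_eq_zero isOpen_Ioo hzero j s (hK hs)]
        exact LipschitzWith.const 0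
  · simp only [ν, sub_self, zero_smul, P2.displace_zero]
  · rw [← hψ]
    funext x
    simpa using hΦX t htJ x

end Geodesics

section Bell

/-- The curve `a ↦ (a^(n+1), a, a^2/2!, …, a^n/n!)`. -/
noncomputable def taylorCurve (n : ℕ) (a : ℝ) (i : Fin (n + 1)) : ℝ :=
  if i = 0 then a ^ (n + 1) else a ^ (i : ℕ) / (i : ℕ)!

theorem taylorCurve_zero (n : ℕ) : taylorCurve n 0 = 0 := by
  funext i
  simp only [taylorCurve]
  split_ifs with h
  · simp
  · have : (i : ℕ) ≠ 0 := fun h' => h (Fin.ext h')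
    simp [this]

theorem contDiff_taylorCurve (n : ℕ) : ContDiff ℝ ∞ (taylorCurve n) := by
  rw [contDiff_pi]
  intro i
  simp only [taylorCurve]
  split_ifs <;> fun_prop

theorem iteratedDeriv_pow_zero (i l : ℕ) :
    iteratedDeriv i (fun a : ℝ => a ^ l) 0 = if i = l then (l ! : ℝ) else 0 := by
  rw [iteratedDeriv_fun_pow_zero]
  split_ifs <;> simp

theorem iteratedDeriv_taylorCurve {n i : ℕ} (h1 : 1 ≤ i) (hn : i ≤ n) :
    iteratedDeriv i (taylorCurve n) 0 = Pi.single (⟨i, by omega⟩ : Fin (n + 1)) 1 := by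
  funext l
  have h2 : iteratedDeriv i (taylorCurve n) 0 l = iteratedDeriv i (fun a => taylorCurve n a l) 0 := by
    rw [iteratedDeriv_eq_iteratedFDeriv, iteratedDeriv_eq_iteratedFDeriv]
    have := (ContinuousLinearMap.proj l : (Fin (n + 1) → ℝ) →L[ℝ] ℝ).iteratedFDeriv_comp_left
      (contDiff_taylorCurve n).contDiffAt (x := (0 : ℝ)) (i := i) (by exact_mod_cast le_top)
    change _ = iteratedFDeriv ℝ i
      ((ContinuousLinearMap.proj l : (Fin (n + 1) → ℝ) →L[ℝ] ℝ) ∘ taylorCurve n) 0 _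
    rw [this]
    rfl
  rw [h2]
  simp only [taylorCurve]
  split_ifs with h
  · subst h
    rw [iteratedDeriv_pow_zero, if_neg (by omega), Pi.single_eq_of_ne]
    intro h
    have := congrArg Fin.val h
    simp at this
    omega
  · simp only [div_eq_inv_mul]
    rw [iteratedDeriv_const_mul_field, iteratedDeriv_pow_zero]
    by_cases hl : i = l
    · have : l = (⟨i, by omega⟩ : Fin (n + 1)) := Fin.ext hl.symm
      rw [if_pos hl, ← this, Pi.single_eq_same, inv_mul_cancel₀ (by positivity)]
    · rw [if_neg hl, mul_zero, Pi.single_eq_of_ne]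
      intro h
      exact hl (congrArg Fin.val h).symm

/-- Derivatives of monomials at the origin. -/
theorem iteratedFDeriv_monomial {ι : Type*} [Fintype ι] [DecidableEq ι] {k m : ℕ} (ψ : Fin k → ι)
    (s : Fin m → ι) :
    iteratedFDeriv ℝ m (fun x : ι → ℝ => ∏ j, x (ψ j)) 0 (fun i => Pi.single (s i) 1) =
      if Multiset.map s Finset.univ.val = Multiset.map ψ Finset.univ.val then
        ((∏ i, (Fintype.card {j // ψ j = i})! : ℕ) : ℝ) else 0 := by
  rcases eq_or_ne m k with rfl | hmk
  · let M : (ι → ℝ) [×m]→L[ℝ] ℝ :=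
      (ContinuousMultilinearMap.mkPiAlgebra ℝ (Fin m) ℝ).compContinuousLinearMap
        fun j => ContinuousLinearMap.proj (ψ j)
    have h1 := M.iteratedFDeriv_comp_diagonal 0 fun i => Pi.single (s i) 1
    simp only [M, ContinuousMultilinearMap.compContinuousLinearMap_apply,
      ContinuousMultilinearMap.mkPiAlgebra_apply, ContinuousLinearMap.proj_apply] at h1
    rw [h1]
    have h2 : ∀ σ : Equiv.Perm (Fin m),
        ∏ j, (Pi.single (s (σ j)) (1 : ℝ) : ι → ℝ) (ψ j) = if ∀ j, s (σ j) = ψ j then 1 else 0 := by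
      intro σ
      split_ifs with h
      · exact Finset.prod_eq_one fun j _ => by rw [h j, Pi.single_eq_same]
      · push Not at h
        obtain ⟨j, hj⟩ := h
        exact Finset.prod_eq_zero (Finset.mem_univ j) (Pi.single_eq_of_ne hj.symm _)
    simp only [h2]
    split_ifs with h
    · obtain ⟨τ, hτ⟩ := exists_perm_of_map_univ_eq h.symm
      have h3 : ∀ σ : Equiv.Perm (Fin m),
          (if ∀ j, s ((τ⁻¹ * σ) j) = ψ j then (1 : ℝ) else 0) = if ψ ∘ σ = ψ then 1 else 0 := by
        intro σ
        refine if_congr ?_ rfl rfl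
        rw [funext_iff]
        refine forall_congr' fun j => ?_
        rw [← hτ]
        simp
      have h4 := Equiv.sum_comp (Equiv.mulLeft τ⁻¹)
        fun σ : Equiv.Perm (Fin m) => if ∀ j, s (σ j) = ψ j then (1 : ℝ) else 0
      rw [← h4]
      refine (Finset.sum_congr rfl fun σ _ => h3 σ).trans ?_
      rw [Finset.sum_boole, ← DomMulAct.stabilizer_card ψ, Fintype.card_subtype]
    · refine Finset.sum_eq_zero fun σ _ => if_neg fun hσ => h ?_
      rw [← funext hσ]
      conv_lhs => rw [← Multiset.map_univ_val_equiv σ, Multiset.map_map]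
      rfl
  · rw [if_neg]
    · let H : (ι → ℝ) → ℝ := fun x => ∏ j, x (ψ j)
      have hH : ContDiff ℝ ∞ H := contDiff_prod fun j _ => contDiff_apply ℝ ℝ (ψ j)
      have hm : ContDiff ℝ m H := hH.of_le (by exact_mod_cast le_top)
      let g : (ι → ℝ) →L[ℝ] (ι → ℝ) := (2 : ℝ) • ContinuousLinearMap.id ℝ _
      have h1 := ContDiffAt.iteratedFDeriv_comp_continuousLinearMap g (x := 0) (f := H) (k := m)
        hm.contDiffAt
      have h2 : (fun x => H (g x)) = (2 : ℝ) ^ k • H := by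
        funext x
        simp [H, g, Finset.prod_mul_distrib]
      rw [h2, iteratedFDeriv_const_smul_apply hm.contDiffAt, map_zero] at h1
      have h3 := congrArg (fun M => M fun i => Pi.single (s i) 1) h1
      simp only [_root_.smul_apply, ContinuousMultilinearMap.compContinuousLinearMap_apply] at h3
      have h4 : ∀ x, g x = (2 : ℝ) • x := fun x => rfl
      simp only [h4] at h3
      rw [ContinuousMultilinearMap.map_smul_univ (iteratedFDeriv ℝ m H 0) (fun _ => (2 : ℝ))] at h3
      simp only [Finset.prod_const, Finset.card_univ, Fintype.card_fin, smul_eq_mul] at h3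
      have h5 : ((2 : ℝ) ^ k - 2 ^ m) *
          iteratedFDeriv ℝ m H 0 (fun i => Pi.single (s i) 1) = 0 := by linarith
      refine (mul_eq_zero.1 h5).resolve_left fun h6 => hmk ?_
      have h7 : (2 : ℝ) ^ k = 2 ^ m := by linarith
      exact (pow_right_injective₀ (by norm_num) (by norm_num) h7).symm
    · intro h
      have := congrArg Multiset.card h
      simp at this
      exact hmk this

/-- The partition of `n` underlying a partition of `Fin n`. -/
def OrderedFinpartition.toPartition {n : ℕ} (c : OrderedFinpartition n) : n.Partition where
  parts := Multiset.map c.partSize Finset.univ.val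
  parts_pos := by
    intro i hi
    obtain ⟨j, -, rfl⟩ := Multiset.mem_map.1 hi
    exact c.partSize_pos j
  parts_sum := by
    change ∑ i, c.partSize i = n
    have := c.sum_sigma_eq_sum (fun _ => 1)
    simpa using this

theorem Nat.Partition.card_parts_mem_Icc {n : ℕ} (hn : 1 ≤ n) (p : n.Partition) :
    p.parts.card ∈ Finset.Icc 1 n := by
  rw [Finset.mem_Icc]
  refine ⟨?_, ?_⟩
  · rw [Nat.one_le_iff_ne_zero]
    intro h
    have := p.parts_sum
    rw [Multiset.card_eq_zero.1 h] at this
    simp at this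
    omega
  · have := Multiset.card_nsmul_le_sum (s := p.parts) (a := 1) fun i hi => p.parts_pos hi
    rw [p.parts_sum] at this
    simpa using this

theorem Nat.Partition.map_sort_getD {n k : ℕ} (p : n.Partition) (hk : p.parts.card = k) :
    Multiset.map (fun i : Fin k => (p.parts.sort (· ≤ ·)).getD i 0) Finset.univ.val = p.parts := by
  subst hk
  conv_rhs => rw [← p.parts.sort_eq (· ≤ ·)]
  rw [Fin.univ_val_map]
  congr 1
  refine List.ext_getElem (by simp) fun i h2 h3 => ?_
  simp

/-- The Bell coefficients count set partitions. -/
theorem card_orderedFinpartition_eq_bellCoeff {n : ℕ} (p : n.Partition) :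
    ((Finset.univ.filter fun c : OrderedFinpartition n => c.toPartition = p).card : ℝ) =
      bellCoeff p := by
  have hle : ∀ i ∈ p.parts, i < n + 1 := fun i hi =>
    Nat.lt_succ_of_le ((Multiset.le_sum_of_mem hi).trans_eq p.parts_sum)
  obtain ⟨k, hk⟩ : ∃ k, p.parts.card = k := ⟨_, rfl⟩
  have hmap := p.map_sort_getD hk
  have hmem : ∀ j : Fin k, (p.parts.sort (· ≤ ·)).getD j 0 ∈ p.parts := fun j => by
    have := Multiset.mem_map_of_mem (fun i : Fin k => (p.parts.sort (· ≤ ·)).getD i 0)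
      (Finset.mem_univ_val j)
    rwa [hmap] at this
  let ψ : Fin k → Fin (n + 1) := fun j => ⟨_, hle _ (hmem j)⟩
  have hψ : Multiset.map (fun j => (ψ j : ℕ)) Finset.univ.val = p.parts := hmap
  have hψsum : ∑ j, (ψ j : ℕ) = n :=
    (congrArg Multiset.sum hψ).trans p.parts_sum
  have hψ0 : ∀ j, ψ j ≠ 0 := fun j h => by
    have := p.parts_pos (hmem j)
    exact this.ne' (congrArg Fin.val h)
  let H : (Fin (n + 1) → ℝ) → ℝ := fun x => ∏ j, x (ψ j)
  have hH : ContDiff ℝ ∞ H := contDiff_prod fun j _ => contDiff_apply ℝ ℝ (ψ j)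
  have hform := iteratedDeriv_comp_eq_sum (n := n) (H := H) (γ := taylorCurve n) (a := 0)
    (hH.contDiffAt.of_le (by exact_mod_cast le_top))
    ((contDiff_taylorCurve n).contDiffAt.of_le (by exact_mod_cast le_top))
  have hleft : iteratedDeriv n (fun t => H (taylorCurve n t)) 0 =
      (∏ j, ((ψ j : ℕ)! : ℝ))⁻¹ * n ! := by
    have : (fun t => H (taylorCurve n t)) = fun t => (∏ j, ((ψ j : ℕ)! : ℝ))⁻¹ * t ^ n := by
      funext t
      simp only [H, taylorCurve, if_neg (hψ0 _)]
      rw [Finset.prod_div_distrib, Finset.prod_pow_eq_pow_sum, hψsum, div_eq_inv_mul]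
    rw [this, iteratedDeriv_const_mul_field, iteratedDeriv_pow_zero, if_pos rfl]
  rw [hleft] at hform
  have hterm : ∀ c : OrderedFinpartition n,
      iteratedFDeriv ℝ c.length H (taylorCurve n 0)
        (fun i => iteratedDeriv (c.partSize i) (taylorCurve n) 0) =
      if c.toPartition = p then ((∏ i, (Fintype.card {j // ψ j = i})! : ℕ) : ℝ) else 0 := by
    intro c
    have h1 : (fun i => iteratedDeriv (c.partSize i) (taylorCurve n) 0) = fun i =>
        Pi.single (⟨c.partSize i, Nat.lt_succ_of_le (c.partSize_le i)⟩ : Fin (n + 1)) 1 :=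
      funext fun i => iteratedDeriv_taylorCurve (c.partSize_pos i) (c.partSize_le i)
    rw [h1, taylorCurve_zero, iteratedFDeriv_monomial]
    refine if_congr ?_ rfl rfl
    rw [Nat.Partition.ext_iff, ← hψ, ← (Multiset.map_injective Fin.val_injective).eq_iff,
      Multiset.map_map, Multiset.map_map]
    rfl
  simp only [hterm] at hform
  rw [← Finset.sum_filter, Finset.sum_const, nsmul_eq_mul] at hform
  have hcount : ∀ i : Fin (n + 1), Fintype.card {j // ψ j = i} = p.parts.count (i : ℕ) := by
    intro i
    rw [← hψ, Multiset.count_map, Fintype.card_subtype, Finset.card, Finset.filter_val]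
    congr 2
    funext j
    simp [Fin.ext_iff, eq_comm]
  have hsub : p.parts.toFinset ⊆ Finset.range (n + 1) := fun i hi =>
    Finset.mem_range.2 (hle i (Multiset.mem_toFinset.1 hi))
  have hprod1 : ∏ i : Fin (n + 1), (Fintype.card {j // ψ j = i})! =
      ∏ i ∈ p.parts.toFinset, (p.parts.count i)! := by
    simp only [hcount]
    rw [Fin.prod_univ_eq_prod_range (fun i => (p.parts.count i)!) (n + 1)]
    refine (Finset.prod_subset hsub fun i _ hi => ?_).symm
    rw [Multiset.mem_toFinset] at hi
    rw [Multiset.count_eq_zero_of_notMem hi, Nat.factorial_zero]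
  have hprod2 : ∏ j, ((ψ j : ℕ)! : ℝ) = ∏ i ∈ p.parts.toFinset, (i ! : ℝ) ^ p.parts.count i := by
    rw [← Finset.prod_multiset_map_count, ← hψ, Multiset.map_map]
    rfl
  rw [hprod1, hprod2] at hform
  have hA : (0 : ℝ) < ∏ i ∈ p.parts.toFinset, (i ! : ℝ) ^ p.parts.count i :=
    Finset.prod_pos fun i _ => by positivity
  have hB : (0 : ℝ) < ∏ i ∈ p.parts.toFinset, ((p.parts.count i)! : ℝ) :=
    Finset.prod_pos fun i _ => by positivity
  rw [bellCoeff, Finset.prod_mul_distrib, eq_div_iff (by positivity)]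
  push_cast at hform
  rw [inv_mul_eq_iff_eq_mul₀ hA.ne'] at hform
  rw [hform]
  ring

/-- A sum of symmetric forms over set partitions, in terms of the Bell polynomials. -/
theorem sum_orderedFinpartition_eq_sum_bellTensor {V : Type*} [AddCommGroup V] [Module ℝ V]
    {n : ℕ} (hn : 1 ≤ n) (D : (k : ℕ) → MultilinearMap ℝ (fun _ : Fin k => V) ℝ)
    (hD : ∀ k, 1 ≤ k → k ≤ n → ∀ (σ : Equiv.Perm (Fin k)) (v : Fin k → V),
      D k (fun i => v (σ i)) = D k v) (X : ℕ → V) :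
    ∑ c : OrderedFinpartition n, D c.length (fun i => X (c.partSize i)) =
      ∑ k ∈ Finset.Icc 1 n, PiTensorProduct.lift (D k) (bellTensor n k X) := by
  let f : (k : ℕ) → n.Partition → ℝ := fun k p =>
    D k fun i : Fin k => X ((p.parts.sort (· ≤ ·)).getD i 0)
  have hc : ∀ c : OrderedFinpartition n, D c.length (fun i => X (c.partSize i)) =
      f c.toPartition.parts.card c.toPartition := by
    intro c
    have hcard : c.toPartition.parts.card = c.length := by
      simp [OrderedFinpartition.toPartition]
    have hIcc := c.toPartition.card_parts_mem_Icc hn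
    rw [hcard] at hIcc ⊢
    obtain ⟨σ, hσ⟩ := exists_perm_of_map_univ_eq
      (s := fun i : Fin c.length => (c.toPartition.parts.sort (· ≤ ·)).getD i 0)
      (r := c.partSize) (c.toPartition.map_sort_getD hcard)
    simp only [← hσ]
    exact hD _ (Finset.mem_Icc.1 hIcc).1 (Finset.mem_Icc.1 hIcc).2 σ
      fun i => X ((c.toPartition.parts.sort (· ≤ ·)).getD i 0)
  have hlift : ∀ k, PiTensorProduct.lift (D k) (bellTensor n k X) =
      ∑ p : n.Partition with p.parts.card = k, bellCoeff p * f p.parts.card p := by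
    intro k
    rw [bellTensor, map_sum]
    refine Finset.sum_congr rfl fun p hp => ?_
    rw [map_smul, PiTensorProduct.lift.tprod, smul_eq_mul]
    obtain rfl := (Finset.mem_filter.1 hp).2
    rfl
  simp only [hlift]
  rw [Finset.sum_fiberwise_of_maps_to (fun p _ => p.card_parts_mem_Icc hn)]
  simp only [hc]
  rw [← Finset.sum_fiberwise_of_maps_to (t := Finset.univ)
    (g := fun c : OrderedFinpartition n => c.toPartition) (fun c _ => Finset.mem_univ _)]
  refine Finset.sum_congr rfl fun p _ => ?_
  rw [← card_orderedFinpartition_eq_bellCoeff, ← nsmul_eq_mul, ← Finset.sum_const]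
  refine Finset.sum_congr rfl fun c hc => ?_
  obtain rfl := (Finset.mem_filter.1 hc).2
  rfl

end Bell

section Deformations

variable {d : ℕ} {A B : Type*} [NormedAddCommGroup A] [NormedSpace ℝ A] [NormedAddCommGroup B]
  [NormedSpace ℝ B]

/-- Smooth families of maps of `ℝ^d` all of whose derivatives in the parameter are Lipschitz in
space, locally uniformly for parameters in `U`. -/
structure IsTameFamily (U : Set A) (W : A → Eucl d → Eucl d) : Prop where
  contDiff : ContDiff ℝ ∞ (Function.uncurry W)
  bound : ∀ j : ℕ, ∀ K ⊆ U, IsCompact K → ∃ L : ℝ≥0, ∀ a ∈ K, ∀ x y,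
    ‖iteratedFDeriv ℝ j (fun b => W b x - W b y) a‖ ≤ L * ‖x - y‖

namespace IsTameFamily

variable {U : Set A} {W W' : A → Eucl d → Eucl d}

theorem contDiff_left (hW : IsTameFamily U W) (x : Eucl d) : ContDiff ℝ ∞ fun a => W a x :=
  hW.contDiff.comp (contDiff_id.prodMk contDiff_const)

theorem contDiff_left_sub (hW : IsTameFamily U W) (x y : Eucl d) {j : ℕ∞} :
    ContDiff ℝ j fun a => W a x - W a y :=
  ((hW.contDiff_left x).sub (hW.contDiff_left y)).of_le (by exact_mod_cast le_top)

theorem const (U : Set A) (Ψ : LipField d) :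
    IsTameFamily U fun (_ : A) => (Ψ : Eucl d → Eucl d) := by
  obtain ⟨L, hL⟩ := Ψ.2.2
  refine ⟨Ψ.2.1.comp contDiff_snd, fun j K _ _ => ?_⟩
  rcases eq_or_ne j 0 with rfl | hj
  · refine ⟨L, fun a _ x y => ?_⟩
    rw [norm_iteratedFDeriv_zero]
    exact hL.norm_sub_le x y
  · refine ⟨0, fun a _ x y => ?_⟩
    rw [iteratedFDeriv_const_of_ne hj]
    simp

theorem add (hW : IsTameFamily U W) (hW' : IsTameFamily U W') :
    IsTameFamily U fun a x => W a x + W' a x := by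
  refine ⟨hW.contDiff.add hW'.contDiff, fun j K hK hKc => ?_⟩
  obtain ⟨L, hL⟩ := hW.bound j K hK hKc
  obtain ⟨L', hL'⟩ := hW'.bound j K hK hKc
  refine ⟨L + L', fun a ha x y => ?_⟩
  have h1 : (fun b => W b x + W' b x - (W b y + W' b y)) =
      (fun b => W b x - W b y) + fun b => W' b x - W' b y := by
    funext b
    simp only [Pi.add_apply]
    abel
  rw [h1, iteratedFDeriv_add_apply (hW.contDiff_left_sub x y (j := j)).contDiffAt
    (hW'.contDiff_left_sub x y (j := j)).contDiffAt, NNReal.coe_add, add_mul]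
  exact norm_add_le_of_le (hL a ha x y) (hL' a ha x y)

theorem sum {ι : Type*} (s : Finset ι) {W : ι → A → Eucl d → Eucl d}
    (hW : ∀ i ∈ s, IsTameFamily U (W i)) : IsTameFamily U fun a x => ∑ i ∈ s, W i a x := by
  classical
  induction s using Finset.induction_on with
  | empty => exact IsTameFamily.const U (0 : LipField d)
  | insert i s hi ih =>
    simp only [Finset.sum_insert hi]
    exact (hW i (Finset.mem_insert_self i s)).add
      (ih fun k hk => hW k (Finset.mem_insert_of_mem hk))

theorem smul (hW : IsTameFamily U W) {c : A → ℝ} (hc : ContDiff ℝ ∞ c) :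
    IsTameFamily U fun a x => c a • W a x := by
  refine ⟨(hc.comp contDiff_fst).smul hW.contDiff, fun j K hK hKc => ?_⟩
  choose L hL using fun i => hW.bound i K hK hKc
  have hb : ∀ i : ℕ, ∃ C : ℝ≥0, ∀ a ∈ K, ‖iteratedFDeriv ℝ i c a‖ ≤ C := fun i => by
    obtain ⟨C, hC⟩ := hKc.exists_bound_of_continuousOn
      (hc.continuous_iteratedFDeriv (m := i) (by exact_mod_cast le_top)).continuousOn
    exact ⟨C.toNNReal, fun a ha => (hC a ha).trans (Real.le_coe_toNNReal C)⟩
  choose C hC using hb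
  refine ⟨∑ i ∈ Finset.range (j + 1), j.choose i * C i * L (j - i), fun a ha x y => ?_⟩
  simp only [← smul_sub]
  refine (norm_iteratedFDeriv_smul_le (N := j) (hc.of_le (by exact_mod_cast le_top))
    (hW.contDiff_left_sub x y) a le_rfl).trans ?_
  push_cast
  rw [Finset.sum_mul]
  refine Finset.sum_le_sum fun i _ => ?_
  rw [mul_assoc (_ * _)]
  gcongr
  · exact hC i a ha
  · exact hL (j - i) a ha x y

theorem comp_continuousLinearMap (hW : IsTameFamily U W) (g : B →L[ℝ] A) :
    IsTameFamily (g ⁻¹' U) fun b => W (g b) := by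
  refine ⟨hW.contDiff.comp ((g.contDiff.comp contDiff_fst).prodMk contDiff_snd),
    fun j K hK hKc => ?_⟩
  obtain ⟨L, hL⟩ := hW.bound j (g '' K) (image_subset_iff.2 hK) (hKc.image g.continuous)
  refine ⟨L * ‖g‖₊ ^ j, fun b hb x y => ?_⟩
  rw [ContDiffAt.iteratedFDeriv_comp_continuousLinearMap g
    (f := fun a => W a x - W a y) (hW.contDiff_left_sub x y (j := j)).contDiffAt]
  refine (ContinuousMultilinearMap.norm_compContinuousLinearMap_le _ _).trans ?_
  rw [Finset.prod_const, Finset.card_univ, Fintype.card_fin]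
  have := hL (g b) (mem_image_of_mem g hb) x y
  push_cast
  rw [mul_right_comm]
  gcongr

theorem exists_lipschitzWith (hW : IsTameFamily U W) {a : A} (ha : a ∈ U) :
    ∃ L : ℝ≥0, LipschitzWith L (W a) := by
  obtain ⟨L, hL⟩ := hW.bound 0 {a} (singleton_subset_iff.2 ha) isCompact_singleton
  refine ⟨L, LipschitzWith.of_dist_le_mul fun x y => ?_⟩
  rw [dist_eq_norm, dist_eq_norm]
  simpa using hL a rfl x y

theorem isSmoothDeformation {m : ℕ} {U : Set (Fin m → ℝ)} {T : (Fin m → ℝ) → Eucl d → Eucl d}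
    (hT : IsTameFamily U T) (hU : IsOpen U) (h0 : (0 : Fin m → ℝ) ∈ U) (hid : ∀ x, T 0 x = x) :
    IsSmoothDeformation U T := by
  refine ⟨hU, h0, funext hid, hT.contDiff.contDiffOn, fun j K hK hKc => ?_⟩
  obtain ⟨L, hL⟩ := hT.bound j K hK hKc
  refine ⟨L, fun a ha => LipschitzWith.of_dist_le_mul fun x y => ?_⟩
  have h1 : ∀ x, ContDiffAt ℝ j (fun b => T b x) a := fun x =>
    (hT.contDiff_left x).contDiffAt.of_le (by exact_mod_cast le_top)
  rw [dist_eq_norm, dist_eq_norm, ← iteratedFDeriv_sub_apply (h1 x) (h1 y)]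
  exact hL a ha x y

end IsTameFamily

theorem IsTameFamily.deriv {U : Set ℝ} {W : ℝ → Eucl d → Eucl d} (hW : IsTameFamily U W) :
    IsTameFamily U fun a x => deriv (fun b => W b x) a := by
  refine ⟨?_, fun j K hK hKc => ?_⟩
  · have := ContDiff.fderiv_apply (𝕜 := ℝ) (m := ∞) (n := ∞)
      (f := fun (z : ℝ × Eucl d) (b : ℝ) => W b z.2) (g := fun z => z.1) (k := fun _ => (1 : ℝ))
      (hW.contDiff.comp (contDiff_snd.prodMk (contDiff_snd.comp contDiff_fst)))
      contDiff_fst contDiff_const (by simp)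
    exact this
  · obtain ⟨L, hL⟩ := hW.bound (j + 1) K hK hKc
    refine ⟨L, fun a ha x y => (le_of_eq ?_).trans (hL a ha x y)⟩
    rw [norm_iteratedFDeriv_eq_norm_iteratedDeriv, norm_iteratedFDeriv_eq_norm_iteratedDeriv,
      _root_.iteratedDeriv_succ']
    congr 2
    funext b
    exact (deriv_fun_sub ((hW.contDiff_left x).differentiable (by simp)).differentiableAt
      ((hW.contDiff_left y).differentiable (by simp)).differentiableAt).symm

theorem IsTameFamily.iteratedDeriv {U : Set ℝ} {W : ℝ → Eucl d → Eucl d} (hW : IsTameFamily U W)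
    (n : ℕ) : IsTameFamily U fun a x => iteratedDeriv n (fun b => W b x) a := by
  induction n with
  | zero => simpa using hW
  | succ n ih =>
    simp only [_root_.iteratedDeriv_succ]
    exact ih.deriv

/-- Averages of a tame family over dilations of the parameter are tame. -/
theorem IsTameFamily.integral_dilation {δ : ℝ} {W : ℝ → Eucl d → Eucl d}
    (hW : IsTameFamily (Ioo (-δ) δ) W) {w : ℝ → ℝ} (hw : ContDiff ℝ ∞ w) :
    IsTameFamily (Ioo (-δ) δ) fun a x => ∫ θ in (0 : ℝ)..1, w θ • W (θ * a) x := by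
  let g : ℝ × ℝ × Eucl d → Eucl d := fun z => w z.1 • W z.2.1 z.2.2
  have hg : ContDiff ℝ ∞ g := (hw.comp contDiff_fst).smul (hW.contDiff.comp contDiff_snd)
  let m0 : C(unitInterval, ℝ × ℝ × Eucl d) := ⟨fun s => ((s : ℝ), 0, 0), by fun_prop⟩
  let m1 : C(unitInterval, ℝ × ℝ × Eucl d) := ⟨fun s => (0, (s : ℝ), 0), by fun_prop⟩
  let Q : ℝ × Eucl d → C(unitInterval, ℝ × ℝ × Eucl d) := fun z => m0 + z.1 • m1 +
    ContinuousLinearMap.const ℝ unitInterval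
      ((ContinuousLinearMap.inr ℝ ℝ (ℝ × Eucl d)) (ContinuousLinearMap.inr ℝ ℝ (Eucl d) z.2))
  have hQ : ContDiff ℝ ∞ Q := by fun_prop
  have hQs : ∀ a x s, Q (a, x) s = ((s : ℝ), s * a, x) := by
    intro a x s
    simp [Q, m0, m1, mul_comm]
  let N : ℝ × Eucl d → C(unitInterval, Eucl d) := fun z =>
    (⟨g, hg.continuous⟩ : C(ℝ × ℝ × Eucl d, Eucl d)).comp (Q z)
  have hN : ContDiff ℝ ∞ N := hg.superposition.comp hQ
  have hNs : ∀ a x s, N (a, x) s = w s • W (s * a) x := fun a x s => by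
    change g (Q (a, x) s) = _
    rw [hQs]
  let P : C(unitInterval, Eucl d) →L[ℝ] Eucl d :=
    (ContinuousMap.evalCLM (M := Eucl d) ℝ (1 : unitInterval)).comp
      (unitIntervalPrimitive (Eucl d))
  have hP : ∀ β, ‖P β‖ ≤ 1 * ‖β‖ := fun β => by
    rw [one_mul]
    exact ((unitIntervalPrimitive (Eucl d) β).norm_coe_le_norm 1).trans
      (norm_unitIntervalPrimitive_le β)
  have hS : ∀ a x, ∫ θ in (0 : ℝ)..1, w θ • W (θ * a) x = P (N (a, x)) := fun a x => by
    change _ = unitIntervalPrimitive (Eucl d) (N (a, x)) 1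
    rw [unitIntervalPrimitive_apply]
    refine intervalIntegral.integral_congr fun θ hθ => ?_
    have hθ' : θ ∈ Icc (0 : ℝ) 1 := by simpa [uIcc_of_le] using hθ
    rw [IccExtend_of_mem _ _ hθ', hNs]
  simp only [hS]
  refine ⟨P.contDiff.comp hN, fun j K hK hKc => ?_⟩
  obtain ⟨r, hr, hKr⟩ : ∃ r < δ, ∀ a ∈ K, |a| ≤ r := by
    rcases K.eq_empty_or_nonempty with rfl | hne
    · exact ⟨δ - 1, by linarith, by simp⟩
    · obtain ⟨a, ha, hmax⟩ := hKc.exists_isMaxOn hne continuous_abs.continuousOn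
      exact ⟨|a|, abs_lt.2 (hK ha), fun b hb => hmax hb⟩
  obtain ⟨L, hL⟩ := hW.bound j (Icc (-r) r)
    (fun a ha => ⟨by linarith [ha.1], by linarith [ha.2]⟩) isCompact_Icc
  obtain ⟨C, hC⟩ := (isCompact_Icc (a := (0 : ℝ)) (b := 1)).exists_bound_of_continuousOn
    hw.continuous.continuousOn
  refine ⟨C.toNNReal * L, fun a ha x y => ?_⟩
  have hCt := Real.le_coe_toNNReal C
  have hG : ContDiff ℝ ∞ fun b => N (b, x) - N (b, y) :=
    (hN.comp (contDiff_id.prodMk contDiff_const)).sub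
      (hN.comp (contDiff_id.prodMk contDiff_const))
  have hGj := hG.contDiffAt (x := a)
  have h1 : (fun b => P (N (b, x)) - P (N (b, y))) = P ∘ fun b => N (b, x) - N (b, y) := by
    funext b
    simp
  rw [h1, P.iteratedFDeriv_comp_left hGj (by exact_mod_cast le_top)]
  refine (ContinuousLinearMap.norm_compContinuousMultilinearMap_le _ _).trans ?_
  refine (mul_le_mul_of_nonneg_right (P.opNorm_le_bound zero_le_one hP) (norm_nonneg _)).trans ?_
  rw [one_mul, norm_iteratedFDeriv_eq_norm_iteratedDeriv,
    ContinuousMap.norm_le _ (by positivity)]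
  intro s
  let ev : C(unitInterval, Eucl d) →L[ℝ] Eucl d := ContinuousMap.evalCLM (M := Eucl d) ℝ s
  have h2 : _root_.iteratedDeriv j (fun b => N (b, x) - N (b, y)) a s =
      iteratedFDeriv ℝ j (ev ∘ fun b => N (b, x) - N (b, y)) a (fun _ => 1) := by
    rw [ev.iteratedFDeriv_comp_left hGj (by exact_mod_cast le_top)]
    rfl
  let γ : ℝ →L[ℝ] ℝ := (s : ℝ) • ContinuousLinearMap.id ℝ ℝ
  have h3 : (ev ∘ fun b => N (b, x) - N (b, y)) =
      w s • fun b : ℝ => (fun c => W c x - W c y) (γ b) := by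
    funext b
    change N (b, x) s - N (b, y) s = _
    rw [hNs, hNs]
    simp [γ, smul_sub]
  have h4 : ContDiff ℝ ∞ fun c => W c x - W c y := hW.contDiff_left_sub x y (j := ⊤)
  have h5 : γ a ∈ Icc (-r) r := by
    refine abs_le.1 ?_
    have : |(s : ℝ) * a| ≤ r := by
      rw [abs_mul, abs_of_nonneg s.2.1]
      exact (mul_le_of_le_one_left (abs_nonneg a) s.2.2).trans (hKr a ha)
    simpa [γ] using this
  have h6 : ContDiffAt ℝ j (fun b : ℝ => (fun c => W c x - W c y) (γ b)) a :=
    (h4.comp γ.contDiff).contDiffAt.of_le (by exact_mod_cast le_top)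
  rw [h2, h3, iteratedFDeriv_const_smul_apply h6,
    ContDiffAt.iteratedFDeriv_comp_continuousLinearMap _ (h4.contDiffAt.of_le
      (by exact_mod_cast le_top))]
  rw [_root_.smul_apply, norm_smul, NNReal.coe_mul, mul_assoc,
    ContinuousMultilinearMap.compContinuousLinearMap_apply]
  refine mul_le_mul ((hC s s.2).trans hCt) ?_ (norm_nonneg _) (by positivity)
  refine (ContinuousMultilinearMap.le_opNorm _ _).trans ?_
  refine (mul_le_of_le_one_right (norm_nonneg _) ?_).trans (hL _ h5 x y)
  refine Finset.prod_le_one (fun _ _ => norm_nonneg _) fun _ _ => ?_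
  simpa [γ, abs_of_nonneg s.2.1] using s.2.2

/-- The flow of a regular transport couple is tame. -/
theorem IsFlowAt.isTameFamily {I : Set ℝ} {Φ : ℝ → Eucl d → Eucl d} {t₀ δ : ℝ}
    {X Y : ℝ → Eucl d → Eucl d} (hX : IsFlowAt I Φ t₀ δ X Y) (hI : IsOpen I) {μ : ℝ → P2 d}
    (hμ : IsRegularTransportCouple I μ Φ) : IsTameFamily (Ioo (-δ) δ) X := by
  refine ⟨hX.contDiff, fun j K hK hKc => ?_⟩
  have hXl : ∀ x, ContDiff ℝ ∞ fun h => X h x := fun x =>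
    hX.contDiff.comp (contDiff_id.prodMk contDiff_const)
  rcases j with - | j
  · refine ⟨2, fun h _ x y => ?_⟩
    rw [norm_iteratedFDeriv_zero]
    exact (hX.lipschitz h).norm_sub_le x y
  · obtain ⟨L, hL⟩ := hμ.lipschitz j ((fun h => t₀ + h) '' K)
      (by
        rintro _ ⟨h, hh, rfl⟩
        exact hX.mem h (abs_lt.2 (hK hh)))
      (hKc.image (continuous_const_add t₀))
    refine ⟨L * 2, fun h hh x y => ?_⟩
    have hh' : |h| < δ := abs_lt.2 (hK hh)
    rw [norm_iteratedFDeriv_eq_norm_iteratedDeriv, iteratedDeriv_fun_sub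
      ((hXl x).contDiffAt.of_le (by exact_mod_cast le_top))
      ((hXl y).contDiffAt.of_le (by exact_mod_cast le_top)),
      hX.iteratedDeriv_succ hI hμ.contDiffOn x j h hh',
      hX.iteratedDeriv_succ hI hμ.contDiffOn y j h hh']
    exact ((hL _ (mem_image_of_mem _ hh)).comp (hX.lipschitz h)).norm_sub_le x y

/-- A finite-parameter deformation of the identity which is linear in the coordinates `i ≥ 1`, with
the iterated convective derivatives as coefficients, and which contains the flow along the curve
`taylorCurve n`. -/
theorem IsFlowAt.exists_deformation {I : Set ℝ} {Φ : ℝ → Eucl d → Eucl d} {t₀ δ : ℝ}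
    {X Y : ℝ → Eucl d → Eucl d} (hX : IsFlowAt I Φ t₀ δ X Y) (hI : IsOpen I) {μ : ℝ → P2 d}
    (hμ : IsRegularTransportCouple I μ Φ) (ht₀ : t₀ ∈ I) {n : ℕ} (hn : 1 ≤ n) :
    ∃ (U : Set (Fin (n + 1) → ℝ)) (T : (Fin (n + 1) → ℝ) → Eucl d → Eucl d), IsOpen U ∧ 0 ∈ U ∧
      IsTameFamily U T ∧ (∀ a x, T (taylorCurve n a) x = X a x) ∧
      ∀ c, c 0 = 0 → ∀ x, T c x =
        x + (∑ i : Fin n, c i.succ • iterConvField hI hμ ht₀ i : LipField d).1 x := by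
  let l : Fin (n + 1) := ⟨1, by omega⟩
  let p : Fin (n + 1) → (Fin (n + 1) → ℝ) →L[ℝ] ℝ := fun i => ContinuousLinearMap.proj i
  let S : ℝ → Eucl d → Eucl d := fun a x => ∫ θ in (0 : ℝ)..1,
    ((n ! : ℝ)⁻¹ * (1 - θ) ^ n) • iteratedDeriv (n + 1) (fun h => X h x) (θ * a)
  have hS : IsTameFamily (Ioo (-δ) δ) S :=
    ((hX.isTameFamily hI hμ).iteratedDeriv (n + 1)).integral_dilation (by fun_prop)
  let U : Set (Fin (n + 1) → ℝ) := p l ⁻¹' Ioo (-δ) δ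
  have hid : (id : Eucl d → Eucl d) ∈ LipField d := ⟨contDiff_id, 1, LipschitzWith.id⟩
  let T : (Fin (n + 1) → ℝ) → Eucl d → Eucl d := fun c x =>
    (x + ∑ i : Fin n, c i.succ • iterConv Φ i t₀ x) + c 0 • S (c l) x
  have hT : IsTameFamily U T :=
    ((IsTameFamily.const U ⟨id, hid⟩).add (IsTameFamily.sum Finset.univ fun (i : Fin n) _ =>
      (IsTameFamily.const U (iterConvField hI hμ ht₀ i)).smul (p i.succ).contDiff)).add
      ((hS.comp_continuousLinearMap (p l)).smul (p 0).contDiff)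
  refine ⟨U, T, isOpen_Ioo.preimage (p l).continuous, ?_, hT, fun a x => ?_, fun c hc x => ?_⟩
  · change p l 0 ∈ Ioo (-δ) δ
    rw [map_zero]
    exact ⟨by linarith [hX.pos], hX.pos⟩
  · have hXx : ContDiff ℝ ∞ fun h => X h x :=
      hX.contDiff.comp (contDiff_id.prodMk contDiff_const)
    have ht := map_add_eq_sum_add_integral_iteratedFDeriv (f := fun h => X h x) (x := 0) (y := a)
      (n := n) fun t _ => hXx.contDiffAt.of_le (by exact_mod_cast le_top)
    have hpow : ∀ (k : ℕ) (b : ℝ), iteratedFDeriv ℝ k (fun h => X h x) b (fun _ => a) =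
        a ^ k • iteratedDeriv k (fun h => X h x) b := fun k b => by
      rw [iteratedDeriv_eq_iteratedFDeriv]
      have := (iteratedFDeriv ℝ k (fun h => X h x) b).map_smul_univ (fun _ => a) fun _ => 1
      simpa using this
    simp only [hpow, zero_add] at ht
    rw [ht, Finset.sum_range_succ', Finset.sum_range]
    have h0 : |(0 : ℝ)| < δ := by simpa using hX.pos
    have hder : ∀ i : ℕ, iteratedDeriv (i + 1) (fun h => X h x) 0 = iterConv Φ i t₀ x := fun i => by
      rw [hX.iteratedDeriv_succ hI hμ.contDiffOn x i 0 h0, add_zero, hX.zero]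
    have hl : taylorCurve n a l = a := by
      have : l ≠ 0 := by simp [l, Fin.ext_iff]
      simp [taylorCurve, this, l]
    have hs : ∀ i : Fin n, taylorCurve n a i.succ =
        (((i : ℕ) + 1)! : ℝ)⁻¹ * a ^ ((i : ℕ) + 1) := fun i => by
      rw [taylorCurve, if_neg (Fin.succ_ne_zero i), div_eq_inv_mul, Fin.val_succ]
    have hz : taylorCurve n a 0 = a ^ (n + 1) := by simp [taylorCurve]
    simp only [T, S, hl, hs, hz, hder, smul_smul]
    rw [add_comm (∑ i : Fin n, _)]
    congr 1
    · simp [hX.zero]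
    · rw [← intervalIntegral.integral_smul, ← intervalIntegral.integral_smul]
      refine intervalIntegral.integral_congr fun θ _ => ?_
      simp only [smul_smul, smul_eq_mul]
      congr 1
      ring
  · simp only [T, hc, zero_smul, add_zero]
    congr 1
    simp [iterConvField]

theorem P2.exists_meas_eq_map (μ : P2 d) {T : Eucl d → Eucl d} {L : ℝ≥0}
    (hT : LipschitzWith L T) : ∃ ν : P2 d, ν.meas = μ.meas.map T :=
  ⟨⟨⟨μ.meas.map T, Measure.isProbabilityMeasure_map hT.continuous.aemeasurable⟩,
    (memLp_map_measure_iff (by fun_prop) hT.continuous.aemeasurable).2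
      (μ.memLp_of_lipschitz hT)⟩, rfl⟩

theorem IsFunctionalCnAt.exists_contDiffAt {F : P2 d → ℝ} {n m : ℕ} {μ : P2 d}
    (hF : IsFunctionalCnAt F n μ) {U : Set (Fin m → ℝ)} {T : (Fin m → ℝ) → Eucl d → Eucl d}
    (hT : IsTameFamily U T) (hU : IsOpen U) (h0 : (0 : Fin m → ℝ) ∈ U) (hid : ∀ x, T 0 x = x) :
    ∃ ν : (Fin m → ℝ) → P2 d, (∀ a ∈ U, (ν a).meas = μ.meas.map (T a)) ∧
      ContDiffAt ℝ n (fun a => F (ν a)) 0 := by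
  have h : ∀ a, ∃ ν : P2 d, a ∈ U → ν.meas = μ.meas.map (T a) := fun a => by
    by_cases ha : a ∈ U
    · obtain ⟨L, hL⟩ := hT.exists_lipschitzWith ha
      obtain ⟨ν, hν⟩ := μ.exists_meas_eq_map hL
      exact ⟨ν, fun _ => hν⟩
    · exact ⟨μ, fun h => absurd h ha⟩
  choose ν hν using h
  exact ⟨ν, hν, hF m U T (hT.isSmoothDeformation hU h0 hid) ν hν⟩

theorem IsFunctionalCnAt.contDiffOnSubspaces {F : P2 d → ℝ} {n : ℕ} {μ : P2 d}
    (hF : IsFunctionalCnAt F n μ) : ContDiffOnSubspaces (fun Ψ => F (μ.displace Ψ)) n := by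
  intro m w
  have hid : (id : Eucl d → Eucl d) ∈ LipField d := ⟨contDiff_id, 1, LipschitzWith.id⟩
  have hT : IsTameFamily univ fun (a : Fin m → ℝ) (x : Eucl d) =>
      x + ∑ i, a i • (w i : Eucl d → Eucl d) x :=
    (IsTameFamily.const univ ⟨id, hid⟩).add (IsTameFamily.sum Finset.univ fun i _ =>
      (IsTameFamily.const univ (w i)).smul
        (ContinuousLinearMap.proj i : (Fin m → ℝ) →L[ℝ] ℝ).contDiff)
  refine hF m univ _ (hT.isSmoothDeformation isOpen_univ (mem_univ _) fun x => by simp)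
    (fun a => μ.displace (∑ i, a i • w i)) fun a _ => ?_
  rw [P2.displace_meas]
  congr 1
  funext x
  simp

end Deformations

section FaaDiBruno

variable {d : ℕ}

theorem ContDiffOnSubspaces.of_le {V : Type*} [AddCommGroup V] [Module ℝ V] {g : V → ℝ} {k n : ℕ}
    (hg : ContDiffOnSubspaces g n) (hkn : k ≤ n) : ContDiffOnSubspaces g k :=
  fun m w => (hg m w).of_le (by exact_mod_cast hkn)

theorem ContDiffOnSubspaces.contDiffAt_smul {V : Type*} [AddCommGroup V] [Module ℝ V] {g : V → ℝ}
    {k : ℕ} (hg : ContDiffOnSubspaces g k) (x : V) : ContDiffAt ℝ k (fun h : ℝ => g (h • x)) 0 := by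
  have h1 := hg 1 fun _ => x
  simp only [Finset.univ_unique, Finset.sum_singleton] at h1
  exact h1.comp (f := fun (h : ℝ) (_ : Fin 1) => h) (0 : ℝ)
    (contDiff_pi.2 fun _ => contDiff_id).contDiffAt

theorem iteratedDeriv_shift (k : ℕ) (f : ℝ → ℝ) (t : ℝ) :
    iteratedDeriv k (fun h => f (t + h)) 0 = iteratedDeriv k f t := by
  simp [iteratedDeriv_comp_const_add]

theorem contDiffAt_of_shift {k : ℕ} {f : ℝ → ℝ} {t : ℝ}
    (h : ContDiffAt ℝ k (fun h => f (t + h)) 0) : ContDiffAt ℝ k f t := by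
  have h1 : f = (fun h => f (t + h)) ∘ fun s => s - t := by
    funext s
    simp
  rw [h1]
  refine ContDiffAt.comp t ?_ (by fun_prop)
  simpa using h

/-- The derivatives of `Ψ ↦ F((id + Ψ)_♯ μ)` at `0` form a Wasserstein differential. -/
theorem isWassersteinDifferential_of_subspaceDeriv {F : P2 d → ℝ} {k : ℕ} {μ : P2 d}
    (hg : ContDiffOnSubspaces (fun Ψ => F (μ.displace Ψ)) k) {D : FieldForm d k}
    (hD : ∀ v, D v = subspaceDeriv (fun Ψ => F (μ.displace Ψ)) k v) :
    IsWassersteinDifferential F k μ D := by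
  refine ⟨fun σ v => ?_, ?_⟩
  · rw [hD, hD]
    exact subspaceDeriv_perm hg σ v
  · rintro J hJ - ν Ψ h t ht rfl
    have hev : (fun s => F (ν (t + s))) =ᶠ[𝓝 0] fun s =>
        F ((ν t).displace (s • iterConvField hJ h.toIsRegularTransportCouple ht 0)) := by
      filter_upwards [h.eventually_eq_displace hJ ht] with s hs
      rw [hs]
    refine ⟨contDiffAt_of_shift (f := fun s => F (ν s)) ?_, ?_⟩
    · exact (hg.contDiffAt_smul _).congr_of_eventuallyEq hev
    · rw [hD, subspaceDeriv_diagonal hg, ← iteratedDeriv_shift]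
      exact hev.iteratedDeriv_eq k

theorem IsWassersteinDifferential.eq {F : P2 d → ℝ} {k : ℕ} {μ : P2 d} {D D' : FieldForm d k}
    (hD : IsWassersteinDifferential F k μ D) (hD' : IsWassersteinDifferential F k μ D') :
    D = D' := by
  refine MultilinearMap.ext_of_diagonal hD.1 hD'.1 fun Ψ => ?_
  obtain ⟨J, hJ, hJc, ht, ν, Φ, h, hν, hΦ⟩ := exists_isConvectiveGeodesic μ Ψ 0
  have h1 : iterConvField hJ h.toIsRegularTransportCouple ht 0 = Ψ := Subtype.ext hΦ
  rw [← h1, ← (hD.2 J hJ hJc ν Φ h 0 ht hν).2, ← (hD'.2 J hJ hJc ν Φ h 0 ht hν).2]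

/-- Locally a functional of class `C^n` along a regular transport couple is a `C^n` function of
finitely many parameters, evaluated along `taylorCurve n`. -/
theorem IsRegularTransportCouple.exists_eq_comp_taylorCurve {I : Set ℝ} (hI : IsOpen I)
    {μ : ℝ → P2 d} {Φ : ℝ → Eucl d → Eucl d} (hμ : IsRegularTransportCouple I μ Φ)
    {F : P2 d → ℝ} {n : ℕ} (hn : 1 ≤ n) {t : ℝ} (ht : t ∈ I) (hF : IsFunctionalCnAt F n (μ t)) :
    ∃ G : (Fin (n + 1) → ℝ) → ℝ, ContDiffAt ℝ n G 0 ∧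
      (fun h => F (μ (t + h))) =ᶠ[𝓝 0] (fun h => G (taylorCurve n h)) ∧
      (fun c : Fin n → ℝ => G (Fin.cons 0 c)) =ᶠ[𝓝 0]
        fun c => F ((μ t).displace (∑ i : Fin n, c i • iterConvField hI hμ ht i)) := by
  obtain ⟨δ, X, Y, hX⟩ := hμ.exists_isFlowAt hI ht
  obtain ⟨U, T, hU, h0, hT, hTX, hTl⟩ := hX.exists_deformation hI hμ ht hn
  obtain ⟨ν, hν, hG⟩ := hF.exists_contDiffAt hT hU h0 fun x => by
    rw [hTl 0 rfl]
    simp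
  refine ⟨fun c => F (ν c), hG, ?_, ?_⟩
  · have h1 : ∀ᶠ h in 𝓝 (0 : ℝ), |h| < δ :=
      (isOpen_lt continuous_abs continuous_const).mem_nhds (by simpa using hX.pos)
    have h2 : ∀ᶠ h in 𝓝 (0 : ℝ), taylorCurve n h ∈ U :=
      (contDiff_taylorCurve n).continuous.continuousAt.eventually_mem
        (by rw [taylorCurve_zero]; exact hU.mem_nhds h0)
    filter_upwards [h1, h2] with h hh hU'
    congr 1
    refine P2.ext ?_
    rw [hν _ hU', hX.map_eq hI hμ.toIsTransportCouple hh]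
    congr 1
    funext x
    exact (hTX h x).symm
  · have hc : Continuous fun c : Fin n → ℝ => (Fin.cons 0 c : Fin (n + 1) → ℝ) := by fun_prop
    have h3 : (Fin.cons 0 (0 : Fin n → ℝ) : Fin (n + 1) → ℝ) = 0 := by
      funext i
      refine Fin.cases ?_ (fun i => ?_) i <;> simp
    have h2 : ∀ᶠ c in 𝓝 (0 : Fin n → ℝ), (Fin.cons 0 c : Fin (n + 1) → ℝ) ∈ U :=
      hc.continuousAt.eventually_mem (by rw [h3]; exact hU.mem_nhds h0)
    filter_upwards [h2] with c hU'
    congr 1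
    refine P2.ext ?_
    rw [hν _ hU', P2.displace_meas]
    congr 1
    funext x
    rw [hTl _ (by simp)]
    simp

theorem IsRegularTransportCouple.contDiffAt_comp {I : Set ℝ} (hI : IsOpen I)
    {μ : ℝ → P2 d} {Φ : ℝ → Eucl d → Eucl d} (hμ : IsRegularTransportCouple I μ Φ)
    {F : P2 d → ℝ} {n : ℕ} (hn : 1 ≤ n) {t : ℝ} (ht : t ∈ I) (hF : IsFunctionalCnAt F n (μ t)) :
    ContDiffAt ℝ n (fun s => F (μ s)) t := by
  obtain ⟨G, hG, hGt, -⟩ := hμ.exists_eq_comp_taylorCurve hI hn ht hF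
  refine contDiffAt_of_shift (f := fun s => F (μ s)) (ContDiffAt.congr_of_eventuallyEq ?_ hGt)
  rw [← taylorCurve_zero n] at hG
  exact hG.comp (0 : ℝ) ((contDiff_taylorCurve n).contDiffAt.of_le (by exact_mod_cast le_top))

/-- Faà di Bruno's formula along a regular transport couple, as a sum over set partitions. -/
theorem IsRegularTransportCouple.iteratedDeriv_comp {I : Set ℝ} (hI : IsOpen I)
    {μ : ℝ → P2 d} {Φ : ℝ → Eucl d → Eucl d} (hμ : IsRegularTransportCouple I μ Φ)
    {F : P2 d → ℝ} {n : ℕ} (hn : 1 ≤ n) {t : ℝ} (ht : t ∈ I) (hF : IsFunctionalCnAt F n (μ t)) :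
    iteratedDeriv n (fun s => F (μ s)) t = ∑ c : OrderedFinpartition n,
      subspaceDeriv (fun Ψ => F ((μ t).displace Ψ)) c.length
        fun i => iterConvField hI hμ ht (c.partSize i - 1) := by
  obtain ⟨G, hG, hGt, hGl⟩ := hμ.exists_eq_comp_taylorCurve hI hn ht hF
  rw [← iteratedDeriv_shift, hGt.iteratedDeriv_eq n, iteratedDeriv_comp_eq_sum
    (by rw [taylorCurve_zero]; exact hG)
    ((contDiff_taylorCurve n).contDiffAt.of_le (by exact_mod_cast le_top))]
  refine Finset.sum_congr rfl fun c _ => ?_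
  let e : (Fin n → ℝ) →L[ℝ] (Fin (n + 1) → ℝ) :=
    ContinuousLinearMap.pi (Fin.cons 0 fun i => ContinuousLinearMap.proj i)
  have he : ∀ c, e c = Fin.cons 0 c := fun c => by
    funext i
    refine Fin.cases ?_ (fun i => ?_) i <;> simp [e]
  have hpos : ∀ i, c.partSize i - 1 < n := fun i => by
    have := c.partSize_pos i
    have := c.partSize_le i
    omega
  have hγ : (fun i => iteratedDeriv (c.partSize i) (taylorCurve n) 0) = fun i =>
      e (Pi.single (⟨c.partSize i - 1, hpos i⟩ : Fin n) 1) := by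
    funext i
    rw [iteratedDeriv_taylorCurve (c.partSize_pos i) (c.partSize_le i), he]
    funext l
    have := c.partSize_pos i
    refine Fin.cases ?_ (fun l => ?_) l
    · rw [Fin.cons_zero, Pi.single_eq_of_ne]
      simp [Fin.ext_iff]
      omega
    · rw [Fin.cons_succ, Pi.single_apply, Pi.single_apply]
      refine if_congr ?_ rfl rfl
      simp only [Fin.ext_iff, Fin.val_succ]
      omega
  have hGc : ContDiffAt ℝ c.length G (e 0) := by
    rw [map_zero]
    exact hG.of_le (by exact_mod_cast c.length_le)
  have h1 := congrArg (fun M => M fun i => Pi.single (⟨c.partSize i - 1, hpos i⟩ : Fin n) 1)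
    (ContDiffAt.iteratedFDeriv_comp_continuousLinearMap e hGc)
  simp only [ContinuousMultilinearMap.compContinuousLinearMap_apply, he] at h1
  rw [(Filter.EventuallyEq.iteratedFDeriv ℝ hGl c.length).eq_of_nhds, iteratedFDeriv_eq_subspaceDeriv
    (hF.contDiffOnSubspaces.of_le c.length_le)
    (fun i : Fin n => iterConvField hI hμ ht i)] at h1
  rw [taylorCurve_zero, hγ]
  simp only [he]
  have h3 : (Fin.cons 0 (0 : Fin n → ℝ) : Fin (n + 1) → ℝ) = 0 := by rw [← he, map_zero]
  rw [h3] at h1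
  rw [← h1]
  congr 1
  funext i
  rw [Finset.sum_eq_single (⟨c.partSize i - 1, hpos i⟩ : Fin n)]
  · simp
  · intro l _ hl
    rw [Pi.single_eq_of_ne hl, zero_smul]
  · simp

end FaaDiBruno

theorem mainTheorem4 {d : ℕ} {I : Set ℝ} (hI : IsOpen I) (hIc : I.OrdConnected)
    {μ : ℝ → P2 d} {Φ : ℝ → Eucl d → Eucl d} (hμ : IsRegularTransportCouple I μ Φ)
    (F : P2 d → ℝ) (n : ℕ) (hn : 1 ≤ n) (hF : ∀ t ∈ I, IsFunctionalCnAt F n (μ t)) :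
    ContDiffOn ℝ n (fun t => F (μ t)) I ∧
    ∀ (t : ℝ) (ht : t ∈ I),
      (∀ k, 1 ≤ k → k ≤ n → ∃! D : FieldForm d k, IsWassersteinDifferential F k (μ t) D) ∧
      ∀ D : (k : ℕ) → FieldForm d k,
        (∀ k, 1 ≤ k → k ≤ n → IsWassersteinDifferential F k (μ t) (D k)) →
        iteratedDeriv n (fun s => F (μ s)) t =
          ∑ k ∈ Finset.Icc 1 n,
            PiTensorProduct.lift (D k)
              (bellTensor n k (fun i => iterConvField hI hμ ht (i - 1))) := by
  refine ⟨fun t ht => (hμ.contDiffAt_comp hI hn ht (hF t ht)).contDiffWithinAt,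
    fun t ht => ?_⟩
  have hg := (hF t ht).contDiffOnSubspaces
  refine ⟨fun k _ hkn => ?_, fun D hD => ?_⟩
  · obtain ⟨D, hD⟩ := exists_multilinearMap_subspaceDeriv (hg.of_le hkn)
    have hW := isWassersteinDifferential_of_subspaceDeriv (hg.of_le hkn) hD
    exact ⟨D, hW, fun D' hD' => hD'.eq hW⟩
  · rw [hμ.iteratedDeriv_comp hI hn ht (hF t ht), ← sum_orderedFinpartition_eq_sum_bellTensor hn D
      (fun k hk hkn => (hD k hk hkn).1)]
    refine Finset.sum_congr rfl fun c _ => ?_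
    obtain ⟨D', hD'⟩ := exists_multilinearMap_subspaceDeriv (hg.of_le c.length_le)
    have hlen : 1 ≤ c.length := c.length_pos (by omega)
    rw [(hD c.length hlen c.length_le).eq
      (isWassersteinDifferential_of_subspaceDeriv (hg.of_le c.length_le) hD'), hD']
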